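/- Let $n\in\mathbb N$, $T>0$ and $\alpha\in(0,1)$. For $t\in[0,T]$ and a measurable essentially bounded $\psi:[0,t]\to\mathbb R^n$ put $(I^\beta\psi)(\tau)=\frac1{\Gamma(\beta)}\int_0^\tau\frac{\psi(\xi)}{(\tau-\xi)^{1-\beta}}\,d\xi$ for $\beta>0$ and $\tau\in[0,t]$. Let $AC^\alpha([0,t],\mathbb R^n)$ be the set of functions $x$ of the form $x(\tau)=x(0)+(I^\alpha\psi)(\tau)$, $\tau\in[0,t]$, with such a $\psi$; it is a subset of $C([0,t],\mathbb R^n)$ with the uniform norm. The Caputo derivative of such an $x$ is $({}^CD^\alpha x)(\tau)=\frac{d}{d\tau}\big(I^{1-\alpha}(x(\cdot)-x(0))\big)(\tau)$, which exists for a.e. $\tau\in[0,t]$. Let $G_n^\alpha$ be the set of pairs $(t,w(\cdot))$ with $t\in[0,T]$ and $w(\cdot)\in AC^\alpha([0,t],\mathbb R^n)$, with the metric $\operatorname{dist}(g,g')=\max\{\operatorname{dist}^*(g,g'),\operatorname{dist}^*(g',g)\}$, where for $g=(t,w(\cdot))$, $g'=(t',w'(\cdot))$ $$\operatorname{dist}^*(g,g')=\max_{\tau\in[0,t]}\min_{\tau'\in[0,t']}\sqrt{|\tau-\tau'|^2+\|w(\tau)-w'(\tau')\|^2}.$$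 For $x(\cdot)$ defined on $[0,T]$, $x_t(\cdot)$ denotes its restriction to $[0,t]$. Let $H:[0,T]\times\mathbb R^n\times\mathbb R^n\to\mathbb R$ be continuous; let $c_H>0$ be such that $|H(t,x,s)-H(t,x,s')|\le c_H(1+\|x\|)\|s-s'\|$ for all $t\in[0,T]$ and $x,s,s'\in\mathbb R^n$; and suppose that for every $R\ge0$ there is $\lambda_H>0$ with $|H(t,x,s)-H(t,x',s)|\le\lambda_H(1+\|s\|)\|x-x'\|$ for all $t\in[0,T]$ and $x,x',s\in\mathbb R^n$ with $\|x\|,\|x'\|\le R$. Let $\sigma:AC^\alpha([0,T],\mathbb R^n)\to\mathbb R$ be continuous. Consider the Cauchy problem $$\partial_t^\alpha\varphi(t,w(\cdot))+H\big(t,w(t),\nabla^\alpha\varphi(t,w(\cdot))\big)=0\quad(t<T),\qquad \varphi(T,w(\cdot))=\sigma(w(\cdot)),$$ with coinvariant derivatives of order $\alpha$; its upper and lower solutions are defined as follows. For $(t_0,w_0(\cdot))\in G_n^\alpha$, $z_0\in\mathbb R$ and $s\in\mathbb R^n$, let $CH(t_0,w_0(\cdot),z_0,s)$ be the set of pairs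 $(x(\cdot),z(\cdot))$ with $x(\cdot)\in AC^\alpha([0,T],\mathbb R^n)$, $z:[0,T]\to\mathbb R$ Lipschitz, $x(t)=w_0(t)$ and $z(t)=z_0$ for $t\in[0,t_0]$, and, for a.e. $t\in[t_0,T]$, $$\|({}^CD^\alpha x)(t)\|\le c_H(1+\|x(t)\|),\qquad \dot z(t)=\langle s,({}^CD^\alpha x)(t)\rangle-H(t,x(t),s).$$ An upper solution is a lower semicontinuous $\varphi:G_n^\alpha\to\mathbb R$ such that $\varphi(T,w(\cdot))\ge\sigma(w(\cdot))$ for all $w(\cdot)\in AC^\alpha([0,T],\mathbb R^n)$ and such that for every $(t_0,w_0(\cdot))\in G_n^\alpha$ with $t_0<T$, every $t\in(t_0,T]$, $s\in\mathbb R^n$ and $\varepsilon>0$ there is $(x(\cdot),z(\cdot))\in CH(t_0,w_0(\cdot),0,s)$ with $\varphi(t,x_t(\cdot))-z(t)\le\varphi(t_0,w_0(\cdot))+\varepsilon$. A lower solution is an upper semicontinuous $\varphi:G_n^\alpha\to\mathbb R$ such that $\varphi(T,w(\cdot))\le\sigma(w(\cdot))$ for all $w(\cdot)\in AC^\alpha([0,T],\mathbb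 R^n)$ and such that, for all such $(t_0,w_0(\cdot))$, $t$, $s$, $\varepsilon$, there is $(x(\cdot),z(\cdot))\in CH(t_0,w_0(\cdot),0,s)$ with $\varphi(t,x_t(\cdot))-z(t)\ge\varphi(t_0,w_0(\cdot))-\varepsilon$. If $\varphi_+$ is an upper solution and $\varphi_-$ is a lower solution of this problem, then $$\varphi_-(t,w(\cdot))\le\varphi_+(t,w(\cdot))\qquad\text{for every }(t,w(\cdot))\in G_n^\alpha.$$ -/

import Mathlib

open Set MeasureTheory

namespace FracHJ

noncomputable section

/-- The space `ℝⁿ` with its Euclidean norm and inner product. -/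
abbrev Vec (n : ℕ) : Type := EuclideanSpace ℝ (Fin n)

/-- The left-sided Riemann–Liouville fractional integral of order `α`,
`(I^α ψ)(τ) = Γ(α)⁻¹ ∫₀^τ ψ(ξ) / (τ - ξ)^(1 - α) dξ`, with `I⁰ ψ = ψ`. -/
def rlIntegral {n : ℕ} (α : ℝ) (ψ : ℝ → Vec n) (τ : ℝ) : Vec n :=
  if α = 0 then ψ τ
  else (Real.Gamma α)⁻¹ • ∫ ξ in (0 : ℝ)..τ, ((τ - ξ) ^ (1 - α))⁻¹ • ψ ξ

/-- The set `AC^α([0, t], ℝⁿ)` of the functions `w` with `w(τ) = w(0) + (I^α ψ)(τ)`,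
`τ ∈ [0, t]`, for some measurable essentially bounded `ψ` on `[0, t]`. It is regarded as a subset
of `C([0, t], ℝⁿ)` (with the topology of uniform convergence). -/
def AC (n : ℕ) (α : ℝ) {t : ℝ} (ht : 0 ≤ t) : Set C(Icc (0 : ℝ) t, Vec n) :=
  {w | ∃ ψ : ℝ → Vec n, MemLp ψ ⊤ (volume.restrict (Icc 0 t)) ∧
    ∀ τ : Icc (0 : ℝ) t, w τ = w ⟨0, left_mem_Icc.2 ht⟩ + rlIntegral α ψ τ}

/-- The Caputo derivative `d/dτ (I^(1-α) (x(·) - x(0)))(τ)` of a function on `[0, T]`. The function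
is continued to `ℝ` by constants; for `τ ∈ (0, T)` this has no influence on the value. -/
def caputo {n : ℕ} (α : ℝ) {T : ℝ} (hT : 0 ≤ T) (x : C(Icc (0 : ℝ) T, Vec n)) (τ : ℝ) : Vec n :=
  deriv (rlIntegral (1 - α) fun ξ => IccExtend hT x ξ - IccExtend hT x 0) τ

/-- The set `G_n` of the pairs `(t, w(·))` with `t ∈ [0, T]` and `w(·) ∈ C([0, t], ℝⁿ)`. -/
structure PathPoint (n : ℕ) (T : ℝ) where
  /-- the time `t` -/
  time : ℝ
  time_nonneg : 0 ≤ time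
  time_le : time ≤ T
  /-- the path `w(·)` -/
  path : C(Icc (0 : ℝ) time, Vec n)

/-- `dist*(g, g') = max_{τ ∈ [0, t]} min_{τ' ∈ [0, t']} √(|τ - τ'|² + ‖w(τ) - w'(τ')‖²)`
for `g = (t, w(·))` and `g' = (t', w'(·))`. -/
def distStar {n : ℕ} {T : ℝ} (g g' : PathPoint n T) : ℝ :=
  ⨆ τ : Icc (0 : ℝ) g.time, ⨅ τ' : Icc (0 : ℝ) g'.time,
    Real.sqrt (|(τ : ℝ) - (τ' : ℝ)| ^ 2 + ‖g.path τ - g'.path τ'‖ ^ 2)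

/-- The metric `dist` on `G_n` (the Hausdorff distance of the graphs). -/
def pathDist {n : ℕ} {T : ℝ} (g g' : PathPoint n T) : ℝ :=
  max (distStar g g') (distStar g' g)

/-- The set `G_n^α` of the pairs `(t, w(·)) ∈ G_n` with `w(·) ∈ AC^α([0, t], ℝⁿ)`. -/
def G (n : ℕ) (α T : ℝ) : Set (PathPoint n T) :=
  {g | g.path ∈ AC n α g.time_nonneg}

/-- The restriction `(t, x_t(·)) ∈ G_n` of a path `x(·)` on `[0, T]` to `[0, t]`. -/
def PathPoint.restr {n : ℕ} {T : ℝ} (x : C(Icc (0 : ℝ) T, Vec n)) (t : Icc (0 : ℝ) T) :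
    PathPoint n T where
  time := t
  time_nonneg := t.2.1
  time_le := t.2.2
  path := x.comp ⟨Set.inclusion (Icc_subset_Icc_right t.2.2), continuous_inclusion _⟩

theorem PathPoint.restr_mem_G {n : ℕ} {α T : ℝ} {hT : 0 ≤ T} {x : C(Icc (0 : ℝ) T, Vec n)}
    (hx : x ∈ AC n α hT) (t : Icc (0 : ℝ) T) : PathPoint.restr x t ∈ G n α T := by
  obtain ⟨ψ, hψ, h⟩ := hx
  refine ⟨ψ, hψ.mono_measure (Measure.restrict_mono (Icc_subset_Icc_right t.2.2) le_rfl), ?_⟩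
  intro τ
  exact h (Set.inclusion (Icc_subset_Icc_right t.2.2) τ)

/-- The element `(t, x_t(·))` of `G_n^α` for `x(·) ∈ AC^α([0, T], ℝⁿ)` and `t ∈ [0, T]`. -/
def trunc {n : ℕ} {α T : ℝ} {hT : 0 ≤ T} (x : AC n α hT) (t : Icc (0 : ℝ) T) : G n α T :=
  ⟨PathPoint.restr x.1 t, PathPoint.restr_mem_G x.2 t⟩

/-- The element `(T, w(·))` of `G_n^α` for `w(·) ∈ AC^α([0, T], ℝⁿ)`. -/
def terminal {n : ℕ} {α T : ℝ} {hT : 0 ≤ T} (w : AC n α hT) : G n α T :=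
  ⟨⟨T, hT, le_rfl, w.1⟩, w.2⟩

/-- Lower semicontinuity of a functional on `G_n^α` with respect to the metric `dist`. -/
def LowerSemicont {n : ℕ} {α T : ℝ} (φ : G n α T → ℝ) : Prop :=
  ∀ g : G n α T, ∀ ε : ℝ, 0 < ε → ∃ δ : ℝ, 0 < δ ∧ ∀ g' : G n α T,
    pathDist g.1 g'.1 < δ → φ g - ε < φ g'

/-- Upper semicontinuity of a functional on `G_n^α` with respect to the metric `dist`. -/
def UpperSemicont {n : ℕ} {α T : ℝ} (φ : G n α T → ℝ) : Prop :=
  ∀ g : G n α T, ∀ ε : ℝ, 0 < ε → ∃ δ : ℝ, 0 < δ ∧ ∀ g' : G n α T,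
    pathDist g.1 g'.1 < δ → φ g' < φ g + ε

/-- `E(t, x, s) = {(f, h) : ‖f‖ ≤ c_H (1 + ‖x‖), h = ⟨s, f⟩ - H(t, x, s)}`. -/
def charSet {n : ℕ} (H : ℝ → Vec n → Vec n → ℝ) (cH : ℝ) (t : ℝ) (x s : Vec n) :
    Set (Vec n × ℝ) :=
  {p | ‖p.1‖ ≤ cH * (1 + ‖x‖) ∧ p.2 = inner ℝ s p.1 - H t x s}

/-- The set `CH(t₀, w₀(·), z₀, s)` of the characteristics: the pairs `(x(·), z(·))` with
`x(·) ∈ AC^α([0, T], ℝⁿ)`, `z(·)` Lipschitz on `[0, T]`, `x = w₀` and `z = z₀` on `[0, t₀]`, and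
`((ᶜD^α x)(t), ż(t)) ∈ E(t, x(t), s)` for a.e. `t ∈ [t₀, T]`. Only the restriction of `z` to
`[0, T]` matters. -/
def CH {n : ℕ} {α T : ℝ} (hT : 0 ≤ T) (H : ℝ → Vec n → Vec n → ℝ) (cH : ℝ)
    (g₀ : G n α T) (z₀ : ℝ) (s : Vec n) : Set (AC n α hT × (ℝ → ℝ)) :=
  {p | (∃ K, LipschitzOnWith K p.2 (Icc 0 T)) ∧
    (∀ τ : Icc (0 : ℝ) g₀.1.time,
      p.1.1 (Set.inclusion (Icc_subset_Icc_right g₀.1.time_le) τ) = g₀.1.path τ) ∧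
    (∀ τ ∈ Icc 0 g₀.1.time, p.2 τ = z₀) ∧
    ∀ᵐ t ∂(volume.restrict (Icc g₀.1.time T)),
      (caputo α hT p.1.1 t, deriv p.2 t) ∈ charSet H cH t (IccExtend hT p.1.1 t) s}

/-- Upper solutions of the Cauchy problem
`∂_t^α φ + H(t, w(t), ∇^α φ) = 0` for `t < T`, `φ(T, w(·)) = σ(w(·))`. -/
structure IsUpperSolution {n : ℕ} {α T : ℝ} (hT : 0 ≤ T) (H : ℝ → Vec n → Vec n → ℝ) (cH : ℝ)
    (σ : AC n α hT → ℝ) (φ : G n α T → ℝ) : Prop where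
  lowerSemicont : LowerSemicont φ
  boundary : ∀ w : AC n α hT, σ w ≤ φ (terminal w)
  stable : ∀ g₀ : G n α T, g₀.1.time < T → ∀ t : Icc (0 : ℝ) T, g₀.1.time < t →
    ∀ s : Vec n, ∀ ε : ℝ, 0 < ε → ∃ p ∈ CH hT H cH g₀ 0 s, φ (trunc p.1 t) - p.2 t ≤ φ g₀ + ε

/-- Lower solutions of the Cauchy problem
`∂_t^α φ + H(t, w(t), ∇^α φ) = 0` for `t < T`, `φ(T, w(·)) = σ(w(·))`. -/
structure IsLowerSolution {n : ℕ} {α T : ℝ} (hT : 0 ≤ T) (H : ℝ → Vec n → Vec n → ℝ) (cH : ℝ)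
    (σ : AC n α hT → ℝ) (φ : G n α T → ℝ) : Prop where
  upperSemicont : UpperSemicont φ
  boundary : ∀ w : AC n α hT, φ (terminal w) ≤ σ w
  stable : ∀ g₀ : G n α T, g₀.1.time < T → ∀ t : Icc (0 : ℝ) T, g₀.1.time < t →
    ∀ s : Vec n, ∀ ε : ℝ, 0 < ε → ∃ p ∈ CH hT H cH g₀ 0 s, φ g₀ - ε ≤ φ (trunc p.1 t) - p.2 t

end

end FracHJ

/-! The proof doubles variables along characteristics. Fix `g` with time t₀ < T and let x and y
continue `g`, x as a characteristic for the upper solution and y for the lower one, both with the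
same vector s. Subtracting the two stability properties, φ₊ − φ₋ grows along the pair by at most the
integral of ⟨s, D^α x − D^α y⟩ − (H(t, x, s) − H(t, y, s)), up to an arbitrarily small error. Put w
= x − y and steer with s = −k e^(−2μt) w. The first term becomes −k e^(−2μt) ⟨w, D^α w⟩, and the
Lipschitz condition in x bounds the second by λ‖w‖ + λ k e^(−2μt) ‖w‖².

The decisive fact is coercivity in a weighted L² space (`exists_coercive`): the integral of e^(−2μt)
⟨w, D^α w⟩ is at least μ^α / S times that of e^(−2μt) ‖w‖². For μ large this dominates the Lipschitz
terms, so the total growth is at most O(1/k) minus a positive multiple of k ∫ ‖w‖²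
(`integral_growth_le`). It is proved by writing r^(α−1) as a superposition of exponentials e^(−θr):
each mode solves y' = −θy + u and satisfies an elementary energy inequality, and the modes are
recombined by Cauchy–Schwarz in θ.

Stability is available only for a constant s, so the feedback is frozen on a fine mesh and the
pieces are concatenated (`exists_step`, `exists_pair`). At time T the boundary conditions give σ(x)
− σ(y) + c k ∫ ‖x − y‖² ≤ φ₊(g) − φ₋(g) + O(1/k) with c > 0 independent of k. All paths involved lie
in one compact set (`exists_bound_continuations`, `isCompact_boundedPaths`). As k → ∞, a subsequence
of the pairs converges to a pair of equal paths, the difference of the values of σ tends to 0, and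
the claim remains. -/

namespace FracHJ

open Filter Topology

/-! ### Fractional integrals, densities and Caputo derivatives. -/

section

/-! ### The weakly singular kernel -/

theorem inv_rpow_one_sub {α r : ℝ} (hr : 0 ≤ r) : (r ^ (1 - α))⁻¹ = r ^ (α - 1) := by
  rw [← Real.rpow_neg hr, neg_sub]

theorem kernel_nonneg {α τ ξ : ℝ} (h : ξ ≤ τ) : 0 ≤ ((τ - ξ) ^ (1 - α))⁻¹ :=
  inv_nonneg.2 (Real.rpow_nonneg (sub_nonneg.2 h) _)

theorem measurable_kernel (α τ : ℝ) : Measurable fun ξ : ℝ => ((τ - ξ) ^ (1 - α))⁻¹ :=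
  ((measurable_const.sub measurable_id).pow_const _).inv

theorem intervalIntegrable_kernel {α a b τ : ℝ} (hα : 0 < α) (ha : a ≤ τ) (hb : b ≤ τ) :
    IntervalIntegrable (fun ξ : ℝ => ((τ - ξ) ^ (1 - α))⁻¹) volume a b := by
  have h : IntervalIntegrable (fun x : ℝ => x ^ (α - 1)) volume (τ - a) (τ - b) :=
    intervalIntegral.intervalIntegrable_rpow' (by linarith)
  have h2 := h.comp_sub_left τ
  simp only [sub_sub_cancel] at h2
  refine h2.congr fun ξ hξ => ?_
  have : ξ ≤ τ := hξ.2.trans (max_le ha hb)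
  exact (inv_rpow_one_sub (sub_nonneg.2 this)).symm

theorem integral_kernel {α a b τ : ℝ} (hα : 0 < α) (ha : a ≤ τ) (hb : b ≤ τ) :
    ∫ ξ in a..b, ((τ - ξ) ^ (1 - α))⁻¹ = ((τ - a) ^ α - (τ - b) ^ α) / α := by
  have h : ∫ ξ in a..b, ((τ - ξ) ^ (1 - α))⁻¹ = ∫ ξ in a..b, (τ - ξ) ^ (α - 1) := by
    refine intervalIntegral.integral_congr_uIoo fun ξ hξ => ?_
    have : ξ ≤ τ := hξ.2.le.trans (max_le ha hb)
    exact inv_rpow_one_sub (sub_nonneg.2 this)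
  rw [h, intervalIntegral.integral_comp_sub_left (fun x => x ^ (α - 1)) τ,
    integral_rpow (Or.inl (by linarith))]
  simp

theorem intervalIntegrable_kernel_smul {E : Type*} [NormedAddCommGroup E] [NormedSpace ℝ E]
    {α a b τ C : ℝ} (hα : 0 < α) (ha : a ≤ τ) (hb : b ≤ τ) {ψ : ℝ → E}
    (hψ : AEStronglyMeasurable ψ (volume.restrict (uIoc a b)))
    (hC : ∀ᵐ ξ ∂volume.restrict (uIoc a b), ‖ψ ξ‖ ≤ C) :
    IntervalIntegrable (fun ξ : ℝ => ((τ - ξ) ^ (1 - α))⁻¹ • ψ ξ) volume a b := by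
  refine ((intervalIntegrable_kernel (α := α) hα ha hb).const_mul C).mono_fun'
    ((measurable_kernel α τ).aestronglyMeasurable.smul hψ) ?_
  filter_upwards [hC, ae_restrict_mem measurableSet_uIoc] with ξ hξ hm
  have : ξ ≤ τ := hm.2.trans (max_le ha hb)
  rw [norm_smul, Real.norm_of_nonneg (kernel_nonneg this), mul_comm]
  exact mul_le_mul_of_nonneg_right hξ (kernel_nonneg this)

/-! ### The Beta integral -/

/-- A translation by r turns this into B(α, 1 − α) scaled to an interval of length τ − r; the orders
add up to 1, so the scaling power and the denominator Γ(1) disappear. -/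
theorem integral_kernel_mul_kernel {α r τ : ℝ} (hα : α ∈ Ioo (0 : ℝ) 1) (hr : r < τ) :
    ∫ ξ in r..τ, ((τ - ξ) ^ α)⁻¹ * ((ξ - r) ^ (1 - α))⁻¹ =
      Real.Gamma α * Real.Gamma (1 - α) := by
  have hs := Complex.betaIntegral_scaled (α : ℂ) ((1 - α : ℝ) : ℂ) (sub_pos.2 hr)
  rw [Complex.betaIntegral_eq_Gamma_mul_div _ _ (by simpa using hα.1)
    (by simpa using hα.2)] at hs
  have e1 : (α : ℂ) + ((1 - α : ℝ) : ℂ) = 1 := by push_cast; ring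
  rw [e1, sub_self, Complex.cpow_zero, one_mul, Complex.Gamma_one, div_one,
    Complex.Gamma_ofReal, Complex.Gamma_ofReal] at hs
  have h2 : ∫ x in (0 : ℝ)..(τ - r), (x : ℂ) ^ ((α : ℂ) - 1) *
      (((τ - r : ℝ) : ℂ) - x) ^ (((1 - α : ℝ) : ℂ) - 1) =
      ((∫ x in (0 : ℝ)..(τ - r), ((τ - r - x) ^ α)⁻¹ * (x ^ (1 - α))⁻¹ : ℝ) : ℂ) := by
    rw [← intervalIntegral.integral_ofReal]
    refine intervalIntegral.integral_congr_uIoo fun x hx => ?_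
    rw [uIoo_of_le (sub_pos.2 hr).le] at hx
    rw [← Complex.ofReal_sub, inv_rpow_one_sub hx.1.le, ← Real.rpow_neg (by linarith [hx.2]),
      Complex.ofReal_mul, Complex.ofReal_cpow hx.1.le, Complex.ofReal_cpow (by linarith [hx.2]),
      mul_comm]
    push_cast
    congr 2
    ring
  rw [h2] at hs
  have h3 : (∫ x in (0 : ℝ)..(τ - r), ((τ - r - x) ^ α)⁻¹ * (x ^ (1 - α))⁻¹) =
      Real.Gamma α * Real.Gamma (1 - α) := by exact_mod_cast hs
  rw [← h3]
  have := intervalIntegral.integral_comp_sub_right (a := r) (b := τ)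
    (fun x : ℝ => ((τ - r - x) ^ α)⁻¹ * (x ^ (1 - α))⁻¹) r
  rw [sub_self] at this
  rw [← this]
  refine intervalIntegral.integral_congr fun ξ _ => ?_
  simp

theorem Gamma_mul_pos {α : ℝ} (hα : α ∈ Ioo (0 : ℝ) 1) :
    0 < Real.Gamma α * Real.Gamma (1 - α) :=
  mul_pos (Real.Gamma_pos_of_pos hα.1) (Real.Gamma_pos_of_pos (sub_pos.2 hα.2))

/-! ### Basic properties of the Riemann–Liouville integral -/

variable {n : ℕ}

theorem rlIntegral_of_pos {α : ℝ} (hα : 0 < α) (ψ : ℝ → Vec n) (τ : ℝ) :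
    rlIntegral α ψ τ = (Real.Gamma α)⁻¹ • ∫ ξ in (0 : ℝ)..τ, ((τ - ξ) ^ (1 - α))⁻¹ • ψ ξ := by
  rw [rlIntegral, if_neg hα.ne']

@[simp]
theorem rlIntegral_zero_right {α : ℝ} (hα : 0 < α) (ψ : ℝ → Vec n) : rlIntegral α ψ 0 = 0 := by
  simp [rlIntegral_of_pos hα]

theorem rlIntegral_congr_ae {α τ : ℝ} (hα : 0 < α) (hτ : 0 ≤ τ) {ψ ψ' : ℝ → Vec n}
    (h : ∀ᵐ ξ ∂volume.restrict (Ioc 0 τ), ψ ξ = ψ' ξ) : rlIntegral α ψ τ = rlIntegral α ψ' τ := by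
  rw [rlIntegral_of_pos hα, rlIntegral_of_pos hα]
  congr 1
  refine intervalIntegral.integral_congr_ae_restrict ?_
  rw [uIoc_of_le hτ]
  filter_upwards [h] with ξ hξ
  simp only [hξ]

theorem rlIntegral_congr {α τ : ℝ} (hα : 0 < α) (hτ : 0 ≤ τ) {ψ ψ' : ℝ → Vec n}
    (h : ∀ ξ ∈ Icc 0 τ, ψ ξ = ψ' ξ) : rlIntegral α ψ τ = rlIntegral α ψ' τ :=
  rlIntegral_congr_ae hα hτ <| (ae_restrict_iff' measurableSet_Ioc).2 <|
    Eventually.of_forall fun ξ hξ => h ξ (Ioc_subset_Icc_self hξ)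

/-- The composition of the fractional integrals of orders `α` and `1 - α` is integration. -/
theorem rlIntegral_rlIntegral {α τ C : ℝ} (hα : α ∈ Ioo (0 : ℝ) 1) (hτ : 0 ≤ τ) {ψ : ℝ → Vec n}
    (hψ : StronglyMeasurable ψ) (hC : ∀ ξ, ‖ψ ξ‖ ≤ C) :
    rlIntegral (1 - α) (rlIntegral α ψ) τ = ∫ ξ in (0 : ℝ)..τ, ψ ξ := by
  have hα1 : 0 < 1 - α := sub_pos.2 hα.2
  set ν := volume.restrict (Ioc 0 τ) with hν
  -- The product of both kernels, cut off to r < ξ so that Fubini applies on the square (0, τ]².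
  let k : ℝ → ℝ → ℝ := fun ξ r =>
    {p : ℝ × ℝ | p.2 < p.1}.indicator
      (fun p => ((τ - p.1) ^ α)⁻¹ * ((p.1 - p.2) ^ (1 - α))⁻¹) (ξ, r)
  have hkm : Measurable (Function.uncurry k) := by
    refine Measurable.indicator ?_ (measurableSet_lt measurable_snd measurable_fst)
    exact ((measurable_const.sub measurable_fst).pow_const _).inv.mul
      ((measurable_fst.sub measurable_snd).pow_const _).inv
  have hk0 : ∀ ξ ∈ Ioc 0 τ, ∀ r, 0 ≤ k ξ r := by
    intro ξ hξ r
    refine indicator_apply_nonneg fun h => mul_nonneg ?_ ?_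
    · exact inv_nonneg.2 (Real.rpow_nonneg (sub_nonneg.2 hξ.2) _)
    · exact kernel_nonneg (le_of_lt h)
  have hkint : ∀ r ∈ Ioc 0 τ, r ≠ τ →
      ∫ ξ, k ξ r ∂ν = Real.Gamma α * Real.Gamma (1 - α) := by
    intro r hr hne
    have hlt : r < τ := lt_of_le_of_ne hr.2 hne
    rw [← integral_kernel_mul_kernel hα hlt, intervalIntegral.integral_of_le hlt.le, hν,
      ← integral_indicator measurableSet_Ioc, ← integral_indicator measurableSet_Ioc]
    congr 1
    ext ξ
    by_cases h1 : ξ ∈ Ioc 0 τ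
    · by_cases h2 : r < ξ
      · rw [indicator_of_mem h1, indicator_of_mem (show ξ ∈ Ioc r τ from ⟨h2, h1.2⟩)]
        exact indicator_of_mem (show (ξ, r) ∈ {p : ℝ × ℝ | p.2 < p.1} from h2) _
      · rw [indicator_of_mem h1, indicator_of_notMem (fun h => h2 h.1)]
        exact indicator_of_notMem (fun h : (ξ, r) ∈ {p : ℝ × ℝ | p.2 < p.1} => h2 h) _
    · rw [indicator_of_notMem h1, indicator_of_notMem]
      exact fun h => h1 ⟨hr.1.trans h.1, h.2⟩
  -- For r = τ the cut-off kernel vanishes and the Beta value fails; a null set.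
  have hne : ∀ᵐ r ∂ν, r ≠ τ := by
    refine ae_restrict_of_ae ?_
    simp [ae_iff, measure_singleton]
  have hki : Integrable (Function.uncurry k) (ν.prod ν) := by
    rw [integrable_prod_iff' hkm.aestronglyMeasurable]
    constructor
    · filter_upwards [ae_restrict_mem measurableSet_Ioc, hne] with r hr hn
      -- A non-integrable function has integral 0 by convention, so the nonzero Beta value already
      -- yields integrability.
      refine Integrable.of_integral_ne_zero ?_
      exact (hkint r hr hn).trans_ne (Gamma_mul_pos hα).ne'
    · refine (integrable_const (Real.Gamma α * Real.Gamma (1 - α))).congr ?_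
      filter_upwards [ae_restrict_mem measurableSet_Ioc, hne] with r hr hn
      rw [← hkint r hr hn]
      refine integral_congr_ae ?_
      filter_upwards [ae_restrict_mem measurableSet_Ioc] with ξ hξ
      exact (Real.norm_of_nonneg (hk0 ξ hξ r)).symm
  have hki2 : Integrable (Function.uncurry fun ξ r => k ξ r • ψ r) (ν.prod ν) := by
    refine (hki.norm.const_mul C).mono' ?_ ?_
    · exact hkm.aestronglyMeasurable.smul (hψ.comp_measurable measurable_snd).aestronglyMeasurable
    · refine Eventually.of_forall fun p => ?_
      simp only [Function.uncurry, norm_smul]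
      rw [mul_comm]
      exact mul_le_mul_of_nonneg_right (hC _) (norm_nonneg _)
  have hin : ∀ ξ ∈ Ioc 0 τ, ((τ - ξ) ^ (1 - (1 - α)))⁻¹ • rlIntegral α ψ ξ =
      (Real.Gamma α)⁻¹ • ∫ r, k ξ r • ψ r ∂ν := by
    intro ξ hξ
    rw [rlIntegral_of_pos hα.1, smul_comm, ← intervalIntegral.integral_smul, sub_sub_cancel,
      intervalIntegral.integral_of_le hξ.1.le, integral_Ioc_eq_integral_Ioo, hν,
      ← integral_indicator measurableSet_Ioo, ← integral_indicator measurableSet_Ioc]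
    congr 2
    ext1 r
    by_cases h1 : r ∈ Ioo 0 ξ
    · rw [indicator_of_mem h1, indicator_of_mem (show r ∈ Ioc 0 τ from ⟨h1.1, h1.2.le.trans hξ.2⟩),
        smul_smul]
      have hk : k ξ r = ((τ - ξ) ^ α)⁻¹ * ((ξ - r) ^ (1 - α))⁻¹ :=
        indicator_of_mem (show (ξ, r) ∈ {p : ℝ × ℝ | p.2 < p.1} from h1.2) _
      rw [hk]
    · rw [indicator_of_notMem h1]
      by_cases h2 : r ∈ Ioc 0 τ
      · rw [indicator_of_mem h2]
        have : k ξ r = 0 := indicator_of_notMem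
          (fun h : (ξ, r) ∈ {p : ℝ × ℝ | p.2 < p.1} => h1 ⟨h2.1, h⟩) _
        rw [this, zero_smul]
      · rw [indicator_of_notMem h2]
  rw [rlIntegral_of_pos hα1, intervalIntegral.integral_of_le hτ,
    setIntegral_congr_fun measurableSet_Ioc hin, integral_smul, ← hν,
    integral_integral_swap hki2, intervalIntegral.integral_of_le hτ, ← hν]
  have : ∫ r, (∫ ξ, k ξ r • ψ r ∂ν) ∂ν =
      ∫ r, (Real.Gamma α * Real.Gamma (1 - α)) • ψ r ∂ν := by
    refine integral_congr_ae ?_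
    filter_upwards [ae_restrict_mem measurableSet_Ioc, hne] with r hr hn
    rw [integral_smul_const, hkint r hr hn]
  rw [this, integral_smul, smul_smul, smul_smul]
  have h1 := (Real.Gamma_pos_of_pos hα.1).ne'
  have h2 := (Real.Gamma_pos_of_pos hα1).ne'
  rw [show (Real.Gamma (1 - α))⁻¹ * (Real.Gamma α)⁻¹ * (Real.Gamma α * Real.Gamma (1 - α)) = 1 by
    field_simp, one_smul]

/-- Hölder continuity of the fractional integral of a bounded function. -/
theorem norm_rlIntegral_sub_le {α C s t : ℝ} (hα : α ∈ Ioo (0 : ℝ) 1) (hs : 0 ≤ s) (hst : s ≤ t)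
    {ψ : ℝ → Vec n} (hψ : StronglyMeasurable ψ) (hC : ∀ ξ, ‖ψ ξ‖ ≤ C) :
    ‖rlIntegral α ψ t - rlIntegral α ψ s‖ ≤
      2 * C / (α * Real.Gamma α) * (t - s) ^ α := by
  have hC0 : 0 ≤ C := (norm_nonneg _).trans (hC 0)
  have hG := Real.Gamma_pos_of_pos hα.1
  have hii : ∀ {a b τ : ℝ}, a ≤ τ → b ≤ τ →
      IntervalIntegrable (fun ξ : ℝ => ((τ - ξ) ^ (1 - α))⁻¹ • ψ ξ) volume a b := fun ha hb =>
    intervalIntegrable_kernel_smul hα.1 ha hb hψ.aestronglyMeasurable (Eventually.of_forall hC)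
  have hst0 : 0 ≤ t := hs.trans hst
  rw [rlIntegral_of_pos hα.1, rlIntegral_of_pos hα.1, ← smul_sub,
    ← intervalIntegral.integral_add_adjacent_intervals (hii hst0 hst) (hii hst le_rfl),
    add_sub_right_comm, ← intervalIntegral.integral_sub (hii hst0 hst) (hii hs le_rfl)]
  -- The kernel decreases when its upper limit grows, so the absolute difference of the kernels is a
  -- signed one and integrates in closed form.
  have h1 : ‖∫ ξ in (0 : ℝ)..s, (((t - ξ) ^ (1 - α))⁻¹ • ψ ξ - ((s - ξ) ^ (1 - α))⁻¹ • ψ ξ)‖ ≤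
      ∫ ξ in (0 : ℝ)..s, C * (((s - ξ) ^ (1 - α))⁻¹ - ((t - ξ) ^ (1 - α))⁻¹) := by
    refine intervalIntegral.norm_integral_le_of_norm_le hs ?_ ?_
    · have : ∀ᵐ ξ : ℝ, ξ ≠ s := by simp [ae_iff, measure_singleton]
      filter_upwards [this] with ξ hne hξ
      have hlt : 0 < s - ξ := sub_pos.2 (lt_of_le_of_ne hξ.2 hne)
      have hmono : ((t - ξ) ^ (1 - α))⁻¹ ≤ ((s - ξ) ^ (1 - α))⁻¹ :=
        inv_anti₀ (Real.rpow_pos_of_pos hlt _)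
          (Real.rpow_le_rpow hlt.le (by linarith) (by linarith [hα.2]))
      rw [← sub_smul, norm_smul, Real.norm_of_nonpos (sub_nonpos.2 hmono), neg_sub, mul_comm]
      exact mul_le_mul_of_nonneg_right (hC ξ) (sub_nonneg.2 hmono)
    · exact ((intervalIntegrable_kernel hα.1 hs le_rfl).sub
        (intervalIntegrable_kernel hα.1 hst0 hst)).const_mul C
  have h2 : ‖∫ ξ in s..t, ((t - ξ) ^ (1 - α))⁻¹ • ψ ξ‖ ≤
      ∫ ξ in s..t, C * ((t - ξ) ^ (1 - α))⁻¹ := by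
    refine intervalIntegral.norm_integral_le_of_norm_le hst ?_
      ((intervalIntegrable_kernel hα.1 hst le_rfl).const_mul C)
    refine Eventually.of_forall fun ξ hξ => ?_
    rw [norm_smul, Real.norm_of_nonneg (kernel_nonneg hξ.2), mul_comm]
    exact mul_le_mul_of_nonneg_right (hC ξ) (kernel_nonneg hξ.2)
  rw [intervalIntegral.integral_const_mul, intervalIntegral.integral_sub
    (intervalIntegrable_kernel hα.1 hs le_rfl) (intervalIntegrable_kernel hα.1 hst0 hst),
    integral_kernel hα.1 hs le_rfl, integral_kernel hα.1 hst0 hst] at h1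
  rw [intervalIntegral.integral_const_mul, integral_kernel hα.1 hst le_rfl] at h2
  simp only [sub_self, sub_zero, Real.zero_rpow hα.1.ne'] at h1 h2
  have h3 : s ^ α ≤ t ^ α := Real.rpow_le_rpow hs hst hα.1.le
  rw [norm_smul, Real.norm_of_nonneg (inv_nonneg.2 hG.le)]
  -- Because s^α ≤ t^α, each of the two pieces is at most C (t − s)^α / α; hence the factor 2.
  have h4 : C * (s ^ α / α - (t ^ α - (t - s) ^ α) / α) + C * ((t - s) ^ α / α) ≤
      2 * C * (t - s) ^ α / α := by
    rw [← sub_div, ← mul_add, ← add_div, mul_div_assoc', div_le_div_iff_of_pos_right hα.1]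
    nlinarith
  calc _ ≤ (Real.Gamma α)⁻¹ * (2 * C * (t - s) ^ α / α) := by
        refine mul_le_mul_of_nonneg_left ?_ (inv_nonneg.2 hG.le)
        exact (norm_add_le _ _).trans ((add_le_add h1 h2).trans h4)
    _ = _ := by
        have := hα.1.ne'
        field_simp

theorem continuousOn_rlIntegral {α C : ℝ} (hα : α ∈ Ioo (0 : ℝ) 1) {ψ : ℝ → Vec n}
    (hψ : StronglyMeasurable ψ) (hC : ∀ ξ, ‖ψ ξ‖ ≤ C) :
    ContinuousOn (rlIntegral α ψ) (Ici 0) := by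
  intro s hs
  have key : ∀ t ∈ Ici (0 : ℝ), ‖rlIntegral α ψ t - rlIntegral α ψ s‖ ≤
      2 * C / (α * Real.Gamma α) * |t - s| ^ α := by
    intro t ht
    rcases le_total s t with h | h
    · rw [abs_of_nonneg (sub_nonneg.2 h)]
      exact norm_rlIntegral_sub_le hα hs h hψ hC
    · rw [norm_sub_rev, abs_sub_comm, abs_of_nonneg (sub_nonneg.2 h)]
      exact norm_rlIntegral_sub_le hα ht h hψ hC
  rw [ContinuousWithinAt, tendsto_iff_norm_sub_tendsto_zero]
  refine squeeze_zero' (Eventually.of_forall fun _ => norm_nonneg _)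
    (eventually_nhdsWithin_of_forall key) ?_
  have : Continuous fun t : ℝ => 2 * C / (α * Real.Gamma α) * |t - s| ^ α :=
    continuous_const.mul ((continuous_id.sub continuous_const).abs.rpow_const
      fun _ => Or.inr hα.1.le)
  have h2 := this.tendsto s
  simp only [sub_self, abs_zero, Real.zero_rpow hα.1.ne', mul_zero] at h2
  exact h2.mono_left nhdsWithin_le_nhds

/-! ### Representation of the elements of `AC` and their Caputo derivatives -/

/-- A density `ψ` of `x`, measurable and bounded everywhere: `x = x(0) + I^α ψ` on `[0, T]`. -/
structure IsDensity {T : ℝ} (α : ℝ) (hT : 0 ≤ T) (x : C(Icc (0 : ℝ) T, Vec n)) (ψ : ℝ → Vec n)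
    (C : ℝ) : Prop where
  stronglyMeasurable : StronglyMeasurable ψ
  norm_le : ∀ ξ, ‖ψ ξ‖ ≤ C
  eq_add : ∀ τ : Icc (0 : ℝ) T, x τ = x ⟨0, left_mem_Icc.2 hT⟩ + rlIntegral α ψ τ

/-- The essential bound becomes a bound at every point: take a measurable representative and set it
to zero where it exceeds the essential supremum. This alters the density on a null set only, which
the fractional integral does not see. -/
theorem exists_isDensity {α T : ℝ} (hα : 0 < α) {hT : 0 ≤ T} {x : C(Icc (0 : ℝ) T, Vec n)}
    (hx : x ∈ AC n α hT) : ∃ ψ C, IsDensity α hT x ψ C := by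
  obtain ⟨ψ, hψ, h⟩ := hx
  set C := (eLpNorm ψ ⊤ (volume.restrict (Icc 0 T))).toReal with hC
  have hb : ∀ᵐ ξ ∂volume.restrict (Icc 0 T), ‖ψ ξ‖ ≤ C := by
    have h1 := ae_le_eLpNormEssSup (f := ψ) (μ := volume.restrict (Icc 0 T))
    filter_upwards [h1] with ξ hξ
    rw [← eLpNorm_exponent_top] at hξ
    have := ENNReal.toReal_mono hψ.2.ne hξ
    simpa only [toReal_enorm] using this
  have hm := hψ.1
  refine ⟨{ξ | ‖hm.mk ψ ξ‖ ≤ C}.indicator (hm.mk ψ), C, ?_, ?_, ?_⟩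
  · exact hm.stronglyMeasurable_mk.indicator
      (measurableSet_le hm.stronglyMeasurable_mk.norm.measurable measurable_const)
  · intro ξ
    by_cases h1 : ξ ∈ {ξ | ‖hm.mk ψ ξ‖ ≤ C}
    · rw [indicator_of_mem h1]; exact h1
    · rw [indicator_of_notMem h1, norm_zero]; exact ENNReal.toReal_nonneg
  · intro τ
    rw [h τ]
    congr 1
    refine rlIntegral_congr_ae hα τ.2.1 ?_
    have hsub : Ioc 0 (τ : ℝ) ⊆ Icc 0 T := fun ξ hξ => ⟨hξ.1.le, hξ.2.trans τ.2.2⟩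
    refine ae_restrict_of_ae_restrict_of_subset hsub ?_
    filter_upwards [hb, hm.ae_eq_mk] with ξ h1 h2
    rw [indicator_of_mem, h2]
    simpa only [mem_ofPred_eq, ← h2] using h1

theorem IsDensity.mem_AC {α T C : ℝ} {hT : 0 ≤ T} {x : C(Icc (0 : ℝ) T, Vec n)} {ψ : ℝ → Vec n}
    (h : IsDensity α hT x ψ C) : x ∈ AC n α hT :=
  ⟨ψ, memLp_top_of_bound h.1.aestronglyMeasurable C (Eventually.of_forall h.2), h.3⟩

theorem IsDensity.extend_sub {α T C : ℝ} {hT : 0 ≤ T} {x : C(Icc (0 : ℝ) T, Vec n)}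
    {ψ : ℝ → Vec n} (h : IsDensity α hT x ψ C) {τ : ℝ} (hτ : τ ∈ Icc 0 T) :
    IccExtend hT x τ - IccExtend hT x 0 = rlIntegral α ψ τ := by
  rw [IccExtend_of_mem hT _ hτ, IccExtend_of_mem hT _ (left_mem_Icc.2 hT), h.3 ⟨τ, hτ⟩,
    add_sub_cancel_left]

theorem IsDensity.rlIntegral_extend_sub {α T C : ℝ} (hα : α ∈ Ioo (0 : ℝ) 1) {hT : 0 ≤ T}
    {x : C(Icc (0 : ℝ) T, Vec n)} {ψ : ℝ → Vec n} (h : IsDensity α hT x ψ C) {τ : ℝ}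
    (hτ : τ ∈ Icc 0 T) :
    rlIntegral (1 - α) (fun ξ => IccExtend hT x ξ - IccExtend hT x 0) τ =
      ∫ ξ in (0 : ℝ)..τ, ψ ξ := by
  rw [← rlIntegral_rlIntegral hα hτ.1 h.1 h.2]
  exact rlIntegral_congr (sub_pos.2 hα.2) hτ.1 fun ξ hξ =>
    h.extend_sub ⟨hξ.1, hξ.2.trans hτ.2⟩

/-- The Caputo derivative coincides almost everywhere with the density. -/
theorem IsDensity.caputo_ae_eq {α T C : ℝ} (hα : α ∈ Ioo (0 : ℝ) 1) {hT : 0 ≤ T}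
    {x : C(Icc (0 : ℝ) T, Vec n)} {ψ : ℝ → Vec n} (h : IsDensity α hT x ψ C) :
    ∀ᵐ t ∂volume.restrict (Icc 0 T), caputo α hT x t = ψ t := by
  have hloc : LocallyIntegrable ψ volume :=
    (memLp_top_of_bound h.1.aestronglyMeasurable C (Eventually.of_forall h.2)).locallyIntegrable
      le_top
  rw [← Measure.restrict_congr_set (Ioo_ae_eq_Icc (a := (0 : ℝ)) (b := T))]
  filter_upwards [ae_restrict_of_ae (LocallyIntegrable.ae_hasDerivAt_integral hloc),
    ae_restrict_mem measurableSet_Ioo] with t ht hm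
  refine HasDerivAt.deriv ((ht 0).congr_of_eventuallyEq ?_)
  filter_upwards [Ioo_mem_nhds hm.1 hm.2] with τ hτ
  exact h.rlIntegral_extend_sub hα (Ioo_subset_Icc_self hτ)

/-- The Caputo derivative at `t` depends only on the values of the function near and before `t`. -/
theorem caputo_congr {α T T' t₁ t : ℝ} (hα : α ∈ Ioo (0 : ℝ) 1) {hT : 0 ≤ T} {hT' : 0 ≤ T'}
    {x : C(Icc (0 : ℝ) T, Vec n)} {y : C(Icc (0 : ℝ) T', Vec n)}
    (h : ∀ τ ∈ Icc 0 t₁, IccExtend hT x τ = IccExtend hT' y τ) (ht : t ∈ Ioo 0 t₁) :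
    caputo α hT x t = caputo α hT' y t := by
  refine EventuallyEq.deriv_eq ?_
  filter_upwards [Ioo_mem_nhds ht.1 ht.2] with τ hτ
  refine rlIntegral_congr (sub_pos.2 hα.2) hτ.1.le fun ξ hξ => ?_
  rw [h ξ ⟨hξ.1, hξ.2.trans hτ.2.le⟩, h 0 ⟨le_rfl, (ht.1.trans ht.2).le⟩]

theorem IsDensity.norm_sub_le {α T C : ℝ} (hα : α ∈ Ioo (0 : ℝ) 1) {hT : 0 ≤ T}
    {x : C(Icc (0 : ℝ) T, Vec n)} {ψ : ℝ → Vec n} (h : IsDensity α hT x ψ C)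
    (s t : Icc (0 : ℝ) T) :
    ‖x s - x t‖ ≤ 2 * C / (α * Real.Gamma α) * |(s : ℝ) - t| ^ α := by
  rw [h.3 s, h.3 t, add_sub_add_left_eq_sub]
  rcases le_total (s : ℝ) t with hst | hst
  · rw [norm_sub_rev, abs_sub_comm, abs_of_nonneg (sub_nonneg.2 hst)]
    exact norm_rlIntegral_sub_le hα s.2.1 hst h.1 h.2
  · rw [abs_of_nonneg (sub_nonneg.2 hst)]
    exact norm_rlIntegral_sub_le hα t.2.1 hst h.1 h.2

end

/-! ### Coercivity of the fractional integral in exponentially weighted L². -/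

section

/-! ### Convolution with exponentials -/

/-- The solution `y` of `y' = -θ y + u`, `y(0) = 0`. -/
noncomputable def expConv (u : ℝ → ℝ) (t θ : ℝ) : ℝ :=
  ∫ ξ in (0 : ℝ)..t, Real.exp (-(θ * (t - ξ))) * u ξ

theorem intervalIntegrable_continuous_mul {C : ℝ} {u f : ℝ → ℝ} (hu : Measurable u)
    (hC : ∀ ξ, |u ξ| ≤ C) (hf : Continuous f) (a b : ℝ) :
    IntervalIntegrable (fun ξ => f ξ * u ξ) volume a b := by
  refine ((hf.abs.intervalIntegrable a b).mul_const C).mono_fun'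
    (hf.measurable.mul hu).aestronglyMeasurable (Eventually.of_forall fun ξ => ?_)
  simp only [norm_mul, Real.norm_eq_abs]
  exact mul_le_mul_of_nonneg_left (hC ξ) (abs_nonneg _)

theorem expConv_eq_exp_mul (u : ℝ → ℝ) (t θ : ℝ) :
    expConv u t θ = Real.exp (-(θ * t)) * ∫ ξ in (0 : ℝ)..t, Real.exp (θ * ξ) * u ξ := by
  rw [expConv, ← intervalIntegral.integral_const_mul]
  refine intervalIntegral.integral_congr fun ξ _ => ?_
  rw [← mul_assoc, ← Real.exp_add]
  congr 2
  ring

theorem continuous_expConv {C : ℝ} {u : ℝ → ℝ} (hu : Measurable u) (hC : ∀ ξ, |u ξ| ≤ C)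
    (θ : ℝ) : Continuous fun t => expConv u t θ := by
  simp_rw [expConv_eq_exp_mul]
  exact (by fun_prop : Continuous fun t => Real.exp (-(θ * t))).mul
    (intervalIntegral.continuous_primitive
      (intervalIntegrable_continuous_mul hu hC (by fun_prop)) 0)

theorem stronglyMeasurable_expConv {C : ℝ} {u : ℝ → ℝ} (hu : Measurable u)
    (hC : ∀ ξ, |u ξ| ≤ C) :
    StronglyMeasurable (Function.uncurry fun t θ => expConv u t θ) := by
  refine stronglyMeasurable_uncurry_of_continuous_of_stronglyMeasurable
    (continuous_expConv hu hC) fun t => ?_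
  have hm : StronglyMeasurable (Function.uncurry fun θ ξ : ℝ =>
      Real.exp (-(θ * (t - ξ))) * u ξ) := by
    refine Measurable.stronglyMeasurable ?_
    have h1 : Measurable fun p : ℝ × ℝ => Real.exp (-(p.1 * (t - p.2))) := by fun_prop
    exact h1.mul (hu.comp measurable_snd)
  simp only [expConv, intervalIntegral]
  exact hm.integral_prod_right.sub hm.integral_prod_right

/-- The integral of the exponential is at most T, and θ times it is at most 1; adding the two
produces the factor 1 + θ. The resulting decay makes the modes integrable against θ^(−α). -/
theorem abs_expConv_le {C T t θ : ℝ} {u : ℝ → ℝ} (hC : ∀ ξ, |u ξ| ≤ C)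
    (ht : t ∈ Icc 0 T) (hθ : 0 < θ) : |expConv u t θ| ≤ C * (T + 1) / (1 + θ) := by
  have hC0 : 0 ≤ C := (abs_nonneg _).trans (hC 0)
  have h1 : |expConv u t θ| ≤ ∫ ξ in (0 : ℝ)..t, C * Real.exp (-(θ * (t - ξ))) := by
    rw [expConv, ← Real.norm_eq_abs]
    refine intervalIntegral.norm_integral_le_of_norm_le
      (g := fun ξ => C * Real.exp (-(θ * (t - ξ)))) ht.1
      (Eventually.of_forall fun ξ _ => ?_)
      (Continuous.intervalIntegrable (μ := volume) (by fun_prop) _ _)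
    rw [norm_mul, Real.norm_of_nonneg (Real.exp_pos _).le, mul_comm]
    exact mul_le_mul_of_nonneg_right (hC ξ) (Real.exp_pos _).le
  rw [intervalIntegral.integral_const_mul] at h1
  have h2 : ∫ ξ in (0 : ℝ)..t, Real.exp (-(θ * (t - ξ))) ≤ T := by
    calc _ ≤ ∫ ξ in (0 : ℝ)..t, (1 : ℝ) := by
          refine intervalIntegral.integral_mono_on ht.1
            (Continuous.intervalIntegrable (by fun_prop) _ _) (by simp) fun ξ hξ => ?_
          rw [Real.exp_le_one_iff, neg_nonpos]
          exact mul_nonneg hθ.le (sub_nonneg.2 hξ.2)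
      _ ≤ T := by simpa using ht.2
  have h3 : θ * ∫ ξ in (0 : ℝ)..t, Real.exp (-(θ * (t - ξ))) ≤ 1 := by
    rw [← intervalIntegral.integral_const_mul]
    have hd : ∀ ξ ∈ uIcc 0 t, HasDerivAt (fun ξ => Real.exp (-(θ * (t - ξ))))
        (θ * Real.exp (-(θ * (t - ξ)))) ξ := by
      intro ξ _
      have : HasDerivAt (fun ξ : ℝ => -(θ * (t - ξ))) θ ξ := by
        simpa using (((hasDerivAt_id ξ).const_sub t).const_mul θ).fun_neg
      simpa [mul_comm] using this.exp
    rw [intervalIntegral.integral_eq_sub_of_hasDerivAt hd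
      (Continuous.intervalIntegrable (by fun_prop) _ _)]
    simp only [sub_self, mul_zero, neg_zero, Real.exp_zero, sub_zero]
    linarith [Real.exp_pos (-(θ * t))]
  rw [le_div_iff₀ (by linarith)]
  calc _ ≤ (C * ∫ ξ in (0 : ℝ)..t, Real.exp (-(θ * (t - ξ)))) * (1 + θ) :=
        mul_le_mul_of_nonneg_right h1 (by linarith)
    _ = C * ((∫ ξ in (0 : ℝ)..t, Real.exp (-(θ * (t - ξ)))) +
        θ * ∫ ξ in (0 : ℝ)..t, Real.exp (-(θ * (t - ξ)))) := by ring
    _ ≤ C * (T + 1) := mul_le_mul_of_nonneg_left (by linarith) hC0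

/-- The energy inequality for `y' = -θ y + u`. -/
theorem energy_expConv {C T : ℝ} {u : ℝ → ℝ} (hu : Measurable u) (hC : ∀ ξ, |u ξ| ≤ C)
    (μ θ : ℝ) :
    (θ + μ) * ∫ t in (0 : ℝ)..T, Real.exp (-(2 * μ * t)) * expConv u t θ ^ 2 ≤
      ∫ t in (0 : ℝ)..T, Real.exp (-(2 * μ * t)) * expConv u t θ * u t := by
  set f : ℝ → ℝ := fun ξ => Real.exp (θ * ξ) * u ξ with hf
  have hfi : ∀ a b, IntervalIntegrable f volume a b :=
    intervalIntegrable_continuous_mul hu hC (by fun_prop)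
  -- Here E · Y² = e^(−2μt) y² with y = `expConv u t θ`. Its a.e. derivative is 2 e^(−2μt) (y u − (θ
  -- + μ) y²); integrating and dropping the nonnegative value at T gives the claim.
  set Y : ℝ → ℝ := fun t => ∫ ξ in (0 : ℝ)..t, f ξ with hY
  set E : ℝ → ℝ := fun t => Real.exp (-(2 * (θ + μ) * t)) with hE
  have hYac : AbsolutelyContinuousOnInterval Y 0 T :=
    (hfi 0 T).absolutelyContinuousOnInterval_intervalIntegral (by simp)
  have hEac : AbsolutelyContinuousOnInterval E 0 T :=
    ContDiffOn.absolutelyContinuousOnInterval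
      (ContDiff.contDiffOn (by rw [hE]; fun_prop))
  have hg := (hEac.mul (hYac.mul hYac)).integral_deriv_eq_sub
  have hd : ∀ᵐ t, t ∈ uIoc 0 T → deriv (fun t => E t * (Y t * Y t)) t =
      2 * (Real.exp (-(2 * μ * t)) * expConv u t θ * u t) -
        2 * (θ + μ) * (Real.exp (-(2 * μ * t)) * expConv u t θ ^ 2) := by
    filter_upwards [(hfi 0 T).ae_hasDerivAt_integral] with t ht hm
    have h1 : HasDerivAt Y (f t) t := ht (uIoc_subset_uIcc hm) 0 left_mem_uIcc
    have h2 : HasDerivAt E (-(2 * (θ + μ)) * E t) t := by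
      have : HasDerivAt (fun t : ℝ => -(2 * (θ + μ) * t)) (-(2 * (θ + μ))) t := by
        simpa using ((hasDerivAt_id t).const_mul (2 * (θ + μ))).fun_neg
      rw [mul_comm]
      exact this.exp
    rw [(h2.fun_mul (h1.fun_mul h1)).deriv, expConv_eq_exp_mul]
    have e1 : E t = Real.exp (-(2 * μ * t)) * Real.exp (-(θ * t)) * Real.exp (-(θ * t)) := by
      rw [← Real.exp_add, ← Real.exp_add]; exact congrArg Real.exp (by ring)
    have e2 : Real.exp (-(θ * t)) * Real.exp (θ * t) = 1 := by
      rw [← Real.exp_add, neg_add_cancel, Real.exp_zero]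
    have e3 : f t = Real.exp (θ * t) * u t := rfl
    rw [e1, e3]
    change _ = 2 * (Real.exp (-(2 * μ * t)) * (Real.exp (-(θ * t)) * Y t) * u t) -
      2 * (θ + μ) * (Real.exp (-(2 * μ * t)) * (Real.exp (-(θ * t)) * Y t) ^ 2)
    linear_combination (2 * Real.exp (-(2 * μ * t)) * Real.exp (-(θ * t)) * Y t * u t) * e2
  have hc := continuous_expConv hu hC θ
  have hi1 : IntervalIntegrable (fun t => Real.exp (-(2 * μ * t)) * expConv u t θ * u t)
      volume 0 T := intervalIntegrable_continuous_mul hu hC (by fun_prop) 0 T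
  have hi2 : IntervalIntegrable (fun t => Real.exp (-(2 * μ * t)) * expConv u t θ ^ 2)
      volume 0 T := Continuous.intervalIntegrable (by fun_prop) _ _
  have hg' : ∫ t in (0 : ℝ)..T, deriv (fun t => E t * (Y t * Y t)) t =
      E T * (Y T * Y T) - E 0 * (Y 0 * Y 0) := hg
  rw [intervalIntegral.integral_congr_ae hd, intervalIntegral.integral_sub
    (hi1.const_mul 2) (hi2.const_mul _), intervalIntegral.integral_const_mul,
    intervalIntegral.integral_const_mul] at hg'
  have hY0 : Y 0 = 0 := by simp [hY]
  rw [hY0] at hg'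
  have : 0 ≤ E T * (Y T * Y T) := mul_nonneg (Real.exp_pos _).le (mul_self_nonneg _)
  linarith

/-! ### Superposition of exponentials -/

/-- Integrable at 0 because α < 1 and at infinity because α > 0. Multiples of this function dominate
the integrands over θ below. -/
theorem integrableOn_rpow_div_one_add {α : ℝ} (hα : α ∈ Ioo (0 : ℝ) 1) :
    IntegrableOn (fun θ : ℝ => θ ^ (-α) / (1 + θ)) (Ioi 0) := by
  have hm : Measurable fun θ : ℝ => θ ^ (-α) / (1 + θ) :=
    (measurable_id.pow_const _).div (measurable_const.add measurable_id)
  rw [← Ioc_union_Ioi_eq_Ioi (zero_le_one (α := ℝ))]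
  refine IntegrableOn.union ?_ ?_
  · have h : IntegrableOn (fun θ : ℝ => θ ^ (-α)) (Ioc 0 1) := by
      have := intervalIntegral.intervalIntegrable_rpow' (a := 0) (b := 1) (r := -α)
        (by linarith [hα.2])
      rwa [intervalIntegrable_iff_integrableOn_Ioc_of_le zero_le_one] at this
    refine h.mono' hm.aestronglyMeasurable ?_
    filter_upwards [ae_restrict_mem measurableSet_Ioc] with θ hθ
    have h0 : 0 ≤ θ ^ (-α) := Real.rpow_nonneg hθ.1.le _
    rw [Real.norm_of_nonneg (div_nonneg h0 (by linarith [hθ.1]))]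
    exact div_le_self h0 (by linarith [hθ.1])
  · have h : IntegrableOn (fun θ : ℝ => θ ^ (-α - 1)) (Ioi 1) :=
      integrableOn_Ioi_rpow_of_lt (by linarith [hα.1]) one_pos
    refine h.mono' hm.aestronglyMeasurable ?_
    filter_upwards [ae_restrict_mem measurableSet_Ioi] with θ hθ
    have hθ0 : 0 < θ := one_pos.trans hθ
    have h0 : 0 ≤ θ ^ (-α) := Real.rpow_nonneg hθ0.le _
    rw [Real.norm_of_nonneg (div_nonneg h0 (by linarith)), Real.rpow_sub_one hθ0.ne']
    exact div_le_div_of_nonneg_left h0 hθ0 (by linarith)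

theorem integrableOn_rpow_div_add {α μ : ℝ} (hα : α ∈ Ioo (0 : ℝ) 1) (hμ : 0 < μ) :
    IntegrableOn (fun θ : ℝ => θ ^ (-α) / (θ + μ)) (Ioi 0) := by
  refine ((integrableOn_rpow_div_one_add hα).const_mul (1 + μ⁻¹)).mono'
    ((measurable_id.pow_const _).div (measurable_id.add_const _)).aestronglyMeasurable ?_
  filter_upwards [ae_restrict_mem measurableSet_Ioi] with θ (hθ : 0 < θ)
  have h0 : 0 ≤ θ ^ (-α) := Real.rpow_nonneg hθ.le _
  rw [Real.norm_of_nonneg (by positivity), mul_div_assoc', div_le_div_iff₀ (by positivity)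
    (by positivity)]
  have : 1 + θ ≤ (1 + μ⁻¹) * (θ + μ) := by
    have h1 : μ⁻¹ * μ = 1 := inv_mul_cancel₀ hμ.ne'
    have h2 : 0 ≤ μ⁻¹ * θ := by positivity
    nlinarith
  calc _ ≤ θ ^ (-α) * ((1 + μ⁻¹) * (θ + μ)) := mul_le_mul_of_nonneg_left this h0
    _ = _ := by ring

theorem integral_rpow_div_add_pos {α μ : ℝ} (hα : α ∈ Ioo (0 : ℝ) 1) (hμ : 0 < μ) :
    0 < ∫ θ in Ioi (0 : ℝ), θ ^ (-α) / (θ + μ) := by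
  rw [setIntegral_pos_iff_support_of_nonneg_ae _ (integrableOn_rpow_div_add hα hμ)]
  · have : Ioi (0 : ℝ) ⊆ Function.support fun θ : ℝ => θ ^ (-α) / (θ + μ) := by
      intro θ (hθ : 0 < θ)
      have : 0 < θ ^ (-α) / (θ + μ) := by positivity
      exact this.ne'
    rw [inter_eq_right.2 this]
    simp
  · filter_upwards [ae_restrict_mem measurableSet_Ioi] with θ (hθ : 0 < θ)
    simp only [Pi.zero_apply]
    positivity

/-- Scaling θ by μ. This is the source of the gain μ^α in the coercivity. -/
theorem integral_rpow_div_add {α μ : ℝ} (hμ : 0 < μ) :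
    μ ^ α * ∫ θ in Ioi (0 : ℝ), θ ^ (-α) / (θ + μ) = ∫ θ in Ioi (0 : ℝ), θ ^ (-α) / (θ + 1) := by
  have h := integral_comp_mul_left_Ioi (fun θ : ℝ => θ ^ (-α) / (θ + μ)) 0 hμ
  rw [mul_zero, smul_eq_mul] at h
  have h2 : ∫ θ in Ioi (0 : ℝ), (μ * θ) ^ (-α) / (μ * θ + μ) =
      μ⁻¹ * (μ ^ (-α) * ∫ θ in Ioi (0 : ℝ), θ ^ (-α) / (θ + 1)) := by
    rw [← integral_const_mul, ← integral_const_mul]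
    refine setIntegral_congr_fun measurableSet_Ioi fun θ (hθ : 0 < θ) => ?_
    rw [Real.mul_rpow hμ.le hθ.le]
    have : θ + 1 ≠ 0 := by positivity
    have : μ * θ + μ ≠ 0 := by positivity
    field_simp
  rw [h2] at h
  have h3 := mul_left_cancel₀ (inv_pos.2 hμ).ne' h
  rw [← h3, ← mul_assoc, ← Real.rpow_add hμ, add_neg_cancel, Real.rpow_zero, one_mul]

theorem integral_rpow_mul_exp {α r : ℝ} (hα : α < 1) (hr : 0 < r) :
    ∫ θ in Ioi (0 : ℝ), θ ^ (-α) * Real.exp (-(θ * r)) =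
      Real.Gamma (1 - α) * (r ^ (1 - α))⁻¹ := by
  have h := Real.integral_rpow_mul_exp_neg_mul_Ioi (sub_pos.2 hα) hr
  rw [one_div, Real.inv_rpow hr.le, mul_comm] at h
  rw [← h]
  refine setIntegral_congr_fun measurableSet_Ioi fun θ _ => ?_
  rw [mul_comm r θ]
  congr 2
  ring

/-- Fubini with the Laplace representation `integral_rpow_mul_exp` of the kernel: the fractional
integral of u is a superposition, with density θ^(−α), of solutions of y' = −θy + u. -/
theorem integral_rpow_mul_expConv {α C t : ℝ} (hα : α ∈ Ioo (0 : ℝ) 1) {u : ℝ → ℝ}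
    (hu : Measurable u) (hC : ∀ ξ, |u ξ| ≤ C) (ht : 0 ≤ t) :
    ∫ θ in Ioi (0 : ℝ), θ ^ (-α) * expConv u t θ =
      Real.Gamma (1 - α) * ∫ ξ in (0 : ℝ)..t, ((t - ξ) ^ (1 - α))⁻¹ * u ξ := by
  have hΓ := Real.Gamma_pos_of_pos (sub_pos.2 hα.2)
  set ν := volume.restrict (Ioc 0 t) with hν
  set ρ := volume.restrict (Ioi (0 : ℝ)) with hρ
  have hne : ∀ᵐ r ∂ν, r ≠ t := by
    refine ae_restrict_of_ae ?_
    simp [ae_iff, measure_singleton]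
  let k : ℝ → ℝ → ℝ := fun ξ θ => θ ^ (-α) * Real.exp (-(θ * (t - ξ)))
  have hkm : Measurable (Function.uncurry k) :=
    (measurable_snd.pow_const (-α)).mul
      (by fun_prop : Measurable fun p : ℝ × ℝ => Real.exp (-(p.2 * (t - p.1))))
  have hkint : ∀ ξ ∈ Ioc 0 t, ξ ≠ t →
      ∫ θ, k ξ θ ∂ρ = Real.Gamma (1 - α) * ((t - ξ) ^ (1 - α))⁻¹ := fun ξ hξ hn =>
    integral_rpow_mul_exp hα.2 (sub_pos.2 (lt_of_le_of_ne hξ.2 hn))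
  have hki : Integrable (Function.uncurry k) (ν.prod ρ) := by
    rw [integrable_prod_iff hkm.aestronglyMeasurable]
    constructor
    · filter_upwards [ae_restrict_mem measurableSet_Ioc, hne] with ξ hξ hn
      refine Integrable.of_integral_ne_zero ((hkint ξ hξ hn).trans_ne ?_)
      have : 0 < t - ξ := sub_pos.2 (lt_of_le_of_ne hξ.2 hn)
      positivity
    · have hi := (intervalIntegrable_kernel (α := α) hα.1 ht le_rfl).const_mul (Real.Gamma (1 - α))
      rw [intervalIntegrable_iff_integrableOn_Ioc_of_le ht] at hi
      refine hi.congr ?_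
      filter_upwards [ae_restrict_mem measurableSet_Ioc, hne] with ξ hξ hn
      rw [← hkint ξ hξ hn]
      refine setIntegral_congr_fun measurableSet_Ioi fun θ (hθ : 0 < θ) => ?_
      exact (Real.norm_of_nonneg (mul_nonneg (Real.rpow_nonneg hθ.le _)
        (Real.exp_pos _).le)).symm
  have hki2 : Integrable (Function.uncurry fun ξ θ => k ξ θ * u ξ) (ν.prod ρ) := by
    refine (hki.norm.mul_const C).mono'
      (hkm.mul (hu.comp measurable_fst)).aestronglyMeasurable ?_
    refine Eventually.of_forall fun p => ?_
    simp only [Function.uncurry, norm_mul]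
    exact mul_le_mul_of_nonneg_left (hC _) (by positivity)
  have hsw := integral_integral_swap hki2
  have e1 : ∀ θ, ∫ ξ, k ξ θ * u ξ ∂ν = θ ^ (-α) * expConv u t θ := by
    intro θ
    rw [expConv, intervalIntegral.integral_of_le ht, ← integral_const_mul]
    refine integral_congr_ae (Eventually.of_forall fun ξ => ?_)
    simp only [k, mul_assoc]
  simp only [e1] at hsw
  rw [← hsw, intervalIntegral.integral_of_le ht, ← integral_const_mul]
  refine integral_congr_ae ?_
  filter_upwards [ae_restrict_mem measurableSet_Ioc, hne] with ξ hξ hn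
  rw [integral_mul_const, hkint ξ hξ hn, mul_assoc]

/-- Coercivity of the fractional integral in exponentially weighted `L²` spaces, in the scalar
case. -/
theorem coercive_scalar {α C T μ : ℝ} (hα : α ∈ Ioo (0 : ℝ) 1) (hμ : 0 < μ) (hT : 0 ≤ T)
    {u w : ℝ → ℝ} (hu : Measurable u) (hC : ∀ ξ, |u ξ| ≤ C)
    (hwc : ContinuousOn w (Icc 0 T))
    (hw : ∀ t ∈ Icc 0 T, w t = ∫ ξ in (0 : ℝ)..t, ((t - ξ) ^ (1 - α))⁻¹ * u ξ) :
    Real.Gamma (1 - α) * μ ^ α * ∫ t in (0 : ℝ)..T, Real.exp (-(2 * μ * t)) * w t ^ 2 ≤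
      (∫ θ in Ioi (0 : ℝ), θ ^ (-α) / (θ + 1)) *
        ∫ t in (0 : ℝ)..T, Real.exp (-(2 * μ * t)) * (w t * u t) := by
  have hΓ := Real.Gamma_pos_of_pos (sub_pos.2 hα.2)
  have hC0 : 0 ≤ C := (abs_nonneg _).trans (hC 0)
  set Γ := Real.Gamma (1 - α) with hΓdef
  set ν := volume.restrict (Ioc 0 T) with hν
  set ρ := volume.restrict (Ioi (0 : ℝ)) with hρ
  set S := ∫ θ, θ ^ (-α) / (θ + μ) ∂ρ with hS
  have hSint : Integrable (fun θ : ℝ => θ ^ (-α) / (θ + μ)) ρ := integrableOn_rpow_div_add hα hμ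
  have hSpos : 0 < S := integral_rpow_div_add_pos hα hμ
  -- The constant on the right turns into μ^α S, so μ^α can be cancelled from both sides.
  rw [← integral_rpow_div_add (α := α) hμ, ← hρ, ← hS]
  have hA : ∀ t ∈ Icc 0 T, ∫ θ, θ ^ (-α) * expConv u t θ ∂ρ = Γ * w t := fun t ht => by
    rw [hw t ht, ← integral_rpow_mul_expConv hα hu hC ht.1]
  have hym := stronglyMeasurable_expConv hu hC
  have hmaj := integrableOn_rpow_div_one_add hα
  have hmaj2 : Integrable (fun p : ℝ × ℝ => p.2 ^ (-α) / (1 + p.2)) (ν.prod ρ) :=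
    hmaj.integrable.comp_snd ν
  have hmem : ∀ᵐ p ∂ν.prod ρ, p.1 ∈ Ioc 0 T ∧ p.2 ∈ Ioi (0 : ℝ) := by
    rw [hν, hρ, Measure.prod_restrict]
    filter_upwards [ae_restrict_mem (measurableSet_Ioc.prod measurableSet_Ioi)] with p hp
    exact hp
  have hexp : ∀ t ∈ Ioc 0 T, Real.exp (-(2 * μ * t)) ≤ 1 := fun t ht => by
    rw [Real.exp_le_one_iff, neg_nonpos]
    have := ht.1
    positivity
  -- `F₁` and `F₂` are the integrands of the right and left sides of `energy_expConv`, weighted by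
  -- θ^(−α).
  let F₁ : ℝ → ℝ → ℝ := fun t θ => θ ^ (-α) * (Real.exp (-(2 * μ * t)) * expConv u t θ * u t)
  let F₂ : ℝ → ℝ → ℝ := fun t θ =>
    θ ^ (-α) * ((θ + μ) * (Real.exp (-(2 * μ * t)) * expConv u t θ ^ 2))
  have hrm : Measurable fun p : ℝ × ℝ => p.2 ^ (-α) := measurable_snd.pow_const _
  have hem : Measurable fun p : ℝ × ℝ => Real.exp (-(2 * μ * p.1)) := by fun_prop
  have hF₁ : Integrable (Function.uncurry F₁) (ν.prod ρ) := by
    refine (hmaj2.const_mul (C * (T + 1) * C)).mono'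
      (hrm.mul ((hem.mul hym.measurable).mul (hu.comp measurable_fst))).aestronglyMeasurable ?_
    filter_upwards [hmem] with p hp
    have hp2 : 0 < p.2 := hp.2
    have h1 := abs_expConv_le hC (Ioc_subset_Icc_self hp.1) hp2
    simp only [Function.uncurry, F₁, norm_mul, Real.norm_eq_abs, Real.abs_exp,
      abs_of_nonneg (Real.rpow_nonneg hp2.le (-α))]
    calc p.2 ^ (-α) * (Real.exp (-(2 * μ * p.1)) * |expConv u p.1 p.2| * |u p.1|)
        ≤ p.2 ^ (-α) * (1 * (C * (T + 1) / (1 + p.2)) * C) := by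
          have := hexp _ hp.1
          have := hC p.1
          gcongr
      _ = _ := by ring
  have hF₂ : Integrable (Function.uncurry F₂) (ν.prod ρ) := by
    refine (hmaj2.const_mul ((1 + μ) * (C * (T + 1)) ^ 2)).mono'
      (hrm.mul ((measurable_snd.add_const μ).mul (hem.mul
        (hym.measurable.pow_const 2)))).aestronglyMeasurable ?_
    filter_upwards [hmem] with p hp
    have hp2 : 0 < p.2 := hp.2
    have h1 := abs_expConv_le hC (Ioc_subset_Icc_self hp.1) hp2
    simp only [Function.uncurry, F₂, norm_mul, Real.norm_eq_abs, Real.abs_exp, abs_pow,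
      abs_of_nonneg (Real.rpow_nonneg hp2.le (-α)), abs_of_pos (add_pos hp2 hμ)]
    calc p.2 ^ (-α) * ((p.2 + μ) * (Real.exp (-(2 * μ * p.1)) * |expConv u p.1 p.2| ^ 2))
        ≤ p.2 ^ (-α) * (((1 + μ) * (1 + p.2)) * (1 * (C * (T + 1) / (1 + p.2)) ^ 2)) := by
          have := hexp _ hp.1
          have h3 : p.2 + μ ≤ (1 + μ) * (1 + p.2) := by nlinarith [mul_pos hμ hp2]
          gcongr
      _ = _ := by
          have : 1 + p.2 ≠ 0 := by positivity
          field_simp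
  have hpt : ∀ t ∈ Ioc 0 T, Integrable (F₂ t) ρ →
      Γ ^ 2 * (Real.exp (-(2 * μ * t)) * w t ^ 2) ≤ S * ∫ θ, F₂ t θ ∂ρ := by
    intro t ht hi
    have hy1 : Integrable (fun θ => θ ^ (-α) * expConv u t θ) ρ := by
      refine (hmaj.integrable.const_mul (C * (T + 1))).mono' ?_ ?_
      · exact ((measurable_id.pow_const (-α)).mul
          (hym.measurable.comp measurable_prodMk_left)).aestronglyMeasurable
      · filter_upwards [ae_restrict_mem measurableSet_Ioi] with θ (hθ : 0 < θ)
        have h1 := abs_expConv_le hC (Ioc_subset_Icc_self ht) hθ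
        rw [norm_mul, Real.norm_of_nonneg (Real.rpow_nonneg hθ.le _)]
        calc _ ≤ θ ^ (-α) * (C * (T + 1) / (1 + θ)) :=
              mul_le_mul_of_nonneg_left h1 (Real.rpow_nonneg hθ.le _)
          _ = _ := by ring
    set e := Real.exp (-(2 * μ * t)) with he
    have he0 : 0 < e := Real.exp_pos _
    -- Cauchy–Schwarz in θ, obtained from 2cy ≤ (θ + μ) y² + c² / (θ + μ). This c maximizes 2cΓw −
    -- c²S, the lower bound that results after integration.
    set c := Γ * w t / S with hc
    have h2 : ∫ θ, (2 * c * e) * (θ ^ (-α) * expConv u t θ) ∂ρ ≤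
        ∫ θ, (F₂ t θ + (c ^ 2 * e) * (θ ^ (-α) / (θ + μ))) ∂ρ := by
      refine integral_mono_ae (hy1.const_mul _) (hi.add (hSint.const_mul _)) ?_
      filter_upwards [ae_restrict_mem measurableSet_Ioi] with θ (hθ : 0 < θ)
      have hθμ : 0 < θ + μ := by positivity
      set y := expConv u t θ with hy
      have h3 : 2 * c * y ≤ (θ + μ) * y ^ 2 + c ^ 2 / (θ + μ) := by
        have : (θ + μ) * y ^ 2 + c ^ 2 / (θ + μ) - 2 * c * y =
            ((θ + μ) * y - c) ^ 2 / (θ + μ) := by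
          field_simp
          ring
        have h4 : 0 ≤ ((θ + μ) * y - c) ^ 2 / (θ + μ) := by positivity
        linarith
      have h5 : 0 ≤ e * θ ^ (-α) := by positivity
      have h6 := mul_le_mul_of_nonneg_left h3 h5
      calc (2 * c * e) * (θ ^ (-α) * y) = e * θ ^ (-α) * (2 * c * y) := by ring
        _ ≤ _ := h6
        _ = θ ^ (-α) * ((θ + μ) * (e * y ^ 2)) + (c ^ 2 * e) * (θ ^ (-α) / (θ + μ)) := by ring
    rw [integral_add hi (hSint.const_mul _), integral_const_mul, integral_const_mul,
      hA t (Ioc_subset_Icc_self ht), ← hS] at h2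
    have h7 : 2 * c * e * (Γ * w t) - c ^ 2 * e * S = Γ ^ 2 * (e * w t ^ 2) / S := by
      rw [hc]
      field_simp
      ring
    have h8 : Γ ^ 2 * (e * w t ^ 2) / S ≤ ∫ θ, F₂ t θ ∂ρ := by linarith
    rwa [div_le_iff₀ hSpos, mul_comm _ S] at h8
  have hwi : Integrable (fun t => Real.exp (-(2 * μ * t)) * w t ^ 2) ν := by
    have : ContinuousOn (fun t => Real.exp (-(2 * μ * t)) * w t ^ 2) (Icc 0 T) :=
      (Continuous.continuousOn (by fun_prop)).mul (hwc.pow 2)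
    exact (this.integrableOn_Icc).mono_set Ioc_subset_Icc_self
  have hmain : Γ ^ 2 * ∫ t, Real.exp (-(2 * μ * t)) * w t ^ 2 ∂ν ≤
      S * (Γ * ∫ t, Real.exp (-(2 * μ * t)) * (w t * u t) ∂ν) := by
    calc _ = ∫ t, Γ ^ 2 * (Real.exp (-(2 * μ * t)) * w t ^ 2) ∂ν := (integral_const_mul _ _).symm
      _ ≤ ∫ t, S * ∫ θ, F₂ t θ ∂ρ ∂ν := by
          refine integral_mono_ae (hwi.const_mul _) (hF₂.integral_prod_left.const_mul _) ?_
          filter_upwards [ae_restrict_mem measurableSet_Ioc, hF₂.prod_right_ae] with t ht hi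
          exact hpt t ht hi
      _ = S * ∫ θ, ∫ t, F₂ t θ ∂ν ∂ρ := by
          rw [integral_const_mul, integral_integral_swap hF₂]
      _ ≤ S * ∫ θ, ∫ t, F₁ t θ ∂ν ∂ρ := by
          refine mul_le_mul_of_nonneg_left ?_ hSpos.le
          refine integral_mono_ae hF₂.integral_prod_right hF₁.integral_prod_right ?_
          filter_upwards [ae_restrict_mem measurableSet_Ioi] with θ (hθ : 0 < θ)
          have h := energy_expConv (T := T) hu hC μ θ
          rw [intervalIntegral.integral_of_le hT, intervalIntegral.integral_of_le hT] at h
          simp only [F₁, F₂, integral_const_mul]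
          exact mul_le_mul_of_nonneg_left h (Real.rpow_nonneg hθ.le _)
      _ = S * ∫ t, ∫ θ, F₁ t θ ∂ρ ∂ν := by rw [integral_integral_swap hF₁]
      _ = S * (Γ * ∫ t, Real.exp (-(2 * μ * t)) * (w t * u t) ∂ν) := by
          congr 1
          rw [← integral_const_mul]
          refine setIntegral_congr_fun measurableSet_Ioc fun t ht => ?_
          have : ∀ θ, F₁ t θ = (Real.exp (-(2 * μ * t)) * u t) * (θ ^ (-α) * expConv u t θ) :=
            fun θ => by simp only [F₁]; ring
          simp only [this]
          rw [integral_const_mul, hA t (Ioc_subset_Icc_self ht)]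
          ring
  rw [intervalIntegral.integral_of_le hT, intervalIntegral.integral_of_le hT]
  have h9 : Γ * ∫ t, Real.exp (-(2 * μ * t)) * w t ^ 2 ∂ν ≤
      S * ∫ t, Real.exp (-(2 * μ * t)) * (w t * u t) ∂ν := by
    have : Γ * (Γ * ∫ t, Real.exp (-(2 * μ * t)) * w t ^ 2 ∂ν) ≤
        Γ * (S * ∫ t, Real.exp (-(2 * μ * t)) * (w t * u t) ∂ν) := by
      calc _ = Γ ^ 2 * ∫ t, Real.exp (-(2 * μ * t)) * w t ^ 2 ∂ν := by ring
        _ ≤ _ := hmain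
        _ = _ := by ring
    exact le_of_mul_le_mul_left this hΓ
  have := mul_le_mul_of_nonneg_left h9 (Real.rpow_nonneg hμ.le α)
  calc _ = μ ^ α * (Γ * ∫ t, Real.exp (-(2 * μ * t)) * w t ^ 2 ∂ν) := by ring
    _ ≤ _ := this
    _ = _ := by ring

variable {n : ℕ}

theorem inner_vec_eq_sum (a b : Vec n) : inner ℝ a b = ∑ j, a j * b j := by
  simp [PiLp.inner_apply, mul_comm]

theorem norm_sq_vec_eq_sum (a : Vec n) : ‖a‖ ^ 2 = ∑ j, a j ^ 2 := by
  rw [← real_inner_self_eq_norm_sq, inner_vec_eq_sum]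
  simp only [sq]

theorem abs_apply_le_norm (a : Vec n) (j : Fin n) : |a j| ≤ ‖a‖ :=
  PiLp.norm_apply_le a j

theorem rlIntegral_apply {α C τ : ℝ} (hα : 0 < α) (hτ : 0 ≤ τ) {ψ : ℝ → Vec n}
    (hψ : StronglyMeasurable ψ) (hC : ∀ ξ, ‖ψ ξ‖ ≤ C) (j : Fin n) :
    rlIntegral α ψ τ j =
      (Real.Gamma α)⁻¹ * ∫ ξ in (0 : ℝ)..τ, ((τ - ξ) ^ (1 - α))⁻¹ * ψ ξ j := by
  have hi := intervalIntegrable_kernel_smul hα hτ le_rfl hψ.aestronglyMeasurable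
    (Eventually.of_forall hC)
  have := (EuclideanSpace.proj (𝕜 := ℝ) j).intervalIntegral_comp_comm hi
  simp only [PiLp.proj_apply, PiLp.smul_apply, smul_eq_mul] at this
  rw [rlIntegral_of_pos hα, PiLp.smul_apply, smul_eq_mul, this]

/-- Coercivity of the fractional integral in exponentially weighted `L²` spaces. -/
theorem exists_coercive {α : ℝ} (hα : α ∈ Ioo (0 : ℝ) 1) : ∃ S : ℝ, 0 < S ∧
    ∀ (n : ℕ) (μ T C : ℝ), 0 < μ → 0 ≤ T → ∀ u : ℝ → Vec n, StronglyMeasurable u →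
      (∀ ξ, ‖u ξ‖ ≤ C) →
      μ ^ α * ∫ t in (0 : ℝ)..T, Real.exp (-(2 * μ * t)) * ‖rlIntegral α u t‖ ^ 2 ≤
        S * ∫ t in (0 : ℝ)..T, Real.exp (-(2 * μ * t)) * inner ℝ (rlIntegral α u t) (u t) := by
  set S₁ := ∫ θ in Ioi (0 : ℝ), θ ^ (-α) / (θ + 1) with hS₁
  have hS0 : 0 < S₁ := integral_rpow_div_add_pos hα one_pos
  have hP := Gamma_mul_pos hα
  have hG := Real.Gamma_pos_of_pos hα.1
  -- Γ(1 − α) comes from the Laplace representation and Γ(α) from the normalization of the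
  -- fractional integral. The quotient is in fact 1, but only positivity matters.
  refine ⟨S₁ / (Real.Gamma α * Real.Gamma (1 - α)), by positivity, ?_⟩
  intro n μ T C hμ hT u hu hC
  have hcont : ContinuousOn (rlIntegral α u) (Icc 0 T) :=
    (continuousOn_rlIntegral hα hu hC).mono Icc_subset_Ici_self
  have hcj : ∀ j : Fin n, ContinuousOn (fun t => rlIntegral α u t j) (Icc 0 T) := fun j =>
    (EuclideanSpace.proj (𝕜 := ℝ) j).continuous.comp_continuousOn hcont
  have huj : ∀ j : Fin n, Measurable fun t => u t j := fun j =>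
    (EuclideanSpace.proj (𝕜 := ℝ) j).continuous.measurable.comp hu.measurable
  have hCj : ∀ (j : Fin n) ξ, |u ξ j| ≤ C := fun j ξ => (abs_apply_le_norm _ j).trans (hC ξ)
  have hi1 : ∀ j : Fin n, IntervalIntegrable
      (fun t => Real.exp (-(2 * μ * t)) * rlIntegral α u t j ^ 2) volume 0 T := fun j => by
    refine ContinuousOn.intervalIntegrable ?_
    rw [uIcc_of_le hT]
    exact (Continuous.continuousOn (by fun_prop)).mul ((hcj j).pow 2)
  have hi2 : ∀ j : Fin n, IntervalIntegrable
      (fun t => Real.exp (-(2 * μ * t)) * (rlIntegral α u t j * u t j)) volume 0 T := fun j => by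
    have h1 : IntervalIntegrable (fun t => Real.exp (-(2 * μ * t)) * rlIntegral α u t j)
        volume 0 T := by
      refine ContinuousOn.intervalIntegrable ?_
      rw [uIcc_of_le hT]
      exact (Continuous.continuousOn (by fun_prop)).mul (hcj j)
    have h2 : IntervalIntegrable
        (fun t => Real.exp (-(2 * μ * t)) * rlIntegral α u t j * u t j) volume 0 T := by
      refine (h1.norm.mul_const C).mono_fun'
        (h1.aestronglyMeasurable_restrict_uIoc.mul (huj j).aestronglyMeasurable)
        (Eventually.of_forall fun t => ?_)
      simp only [norm_mul _ (u t j)]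
      exact mul_le_mul_of_nonneg_left (hCj j t) (norm_nonneg _)
    simpa only [mul_assoc] using h2
  have key : ∀ j : Fin n, Real.Gamma α * Real.Gamma (1 - α) *
      (μ ^ α * ∫ t in (0 : ℝ)..T, Real.exp (-(2 * μ * t)) * rlIntegral α u t j ^ 2) ≤
      S₁ * ∫ t in (0 : ℝ)..T, Real.exp (-(2 * μ * t)) * (rlIntegral α u t j * u t j) := by
    intro j
    have h := coercive_scalar (w := fun t => Real.Gamma α * rlIntegral α u t j) hα hμ hT (huj j)
      (hCj j) (continuousOn_const.mul (hcj j)) fun t ht => by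
        rw [rlIntegral_apply hα.1 ht.1 hu hC j, mul_inv_cancel_left₀ hG.ne']
    have e1 : ∀ t, Real.exp (-(2 * μ * t)) * (Real.Gamma α * rlIntegral α u t j) ^ 2 =
      Real.Gamma α ^ 2 * (Real.exp (-(2 * μ * t)) * rlIntegral α u t j ^ 2) := fun t => by ring
    have e2 : ∀ t, Real.exp (-(2 * μ * t)) * (Real.Gamma α * rlIntegral α u t j * u t j) =
      Real.Gamma α * (Real.exp (-(2 * μ * t)) * (rlIntegral α u t j * u t j)) := fun t => by ring
    simp only [e1, e2, intervalIntegral.integral_const_mul] at h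
    refine le_of_mul_le_mul_left (le_trans (le_of_eq ?_) (h.trans (le_of_eq ?_))) hG
    · ring
    · rw [← hS₁]; ring
  have e3 : ∫ t in (0 : ℝ)..T, Real.exp (-(2 * μ * t)) * ‖rlIntegral α u t‖ ^ 2 =
      ∑ j, ∫ t in (0 : ℝ)..T, Real.exp (-(2 * μ * t)) * rlIntegral α u t j ^ 2 := by
    rw [← intervalIntegral.integral_finsetSum fun j _ => hi1 j]
    simp only [norm_sq_vec_eq_sum, Finset.mul_sum]
  have e4 : ∫ t in (0 : ℝ)..T, Real.exp (-(2 * μ * t)) * inner ℝ (rlIntegral α u t) (u t) =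
      ∑ j, ∫ t in (0 : ℝ)..T, Real.exp (-(2 * μ * t)) * (rlIntegral α u t j * u t j) := by
    rw [← intervalIntegral.integral_finsetSum fun j _ => hi2 j]
    simp only [inner_vec_eq_sum, Finset.mul_sum]
  rw [e3, e4, div_mul_eq_mul_div, le_div_iff₀ hP, Finset.mul_sum, Finset.mul_sum, Finset.sum_mul]
  refine Finset.sum_le_sum fun j _ => ?_
  rw [mul_comm]
  exact key j

end

/-! ### Compactness of sets of paths with bounded density. -/

section

variable {n : ℕ}

/-! ### Compact sets of paths -/

theorem norm_extend_sub_le {T : ℝ} {hT : 0 ≤ T} (x : C(Icc (0 : ℝ) T, Vec n)) (ξ : ℝ) :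
    ‖IccExtend hT x ξ - IccExtend hT x 0‖ ≤ 2 * ‖x‖ := by
  refine (norm_sub_le _ _).trans ?_
  rw [two_mul]
  exact add_le_add (x.norm_coe_le_norm _) (x.norm_coe_le_norm _)

/-- The fractional integral of order `1 - α` of `x - x(0)`. -/
noncomputable def rlDefect {T : ℝ} (α : ℝ) (hT : 0 ≤ T) (x : C(Icc (0 : ℝ) T, Vec n)) (t : ℝ) :
    Vec n :=
  rlIntegral (1 - α) (fun ξ => IccExtend hT x ξ - IccExtend hT x 0) t

/-- Integration against an integrable kernel is Lipschitz in the uniform norm. -/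
theorem continuous_rlDefect {α T t : ℝ} (hα : α ∈ Ioo (0 : ℝ) 1) {hT : 0 ≤ T} (ht : 0 ≤ t) :
    Continuous fun x : C(Icc (0 : ℝ) T, Vec n) => rlDefect α hT x t := by
  have hα1 : 0 < 1 - α := sub_pos.2 hα.2
  have hΓ := Real.Gamma_pos_of_pos hα1
  have hii : ∀ x : C(Icc (0 : ℝ) T, Vec n), IntervalIntegrable
      (fun ξ : ℝ => ((t - ξ) ^ (1 - (1 - α)))⁻¹ • (IccExtend hT x ξ - IccExtend hT x 0))
      volume 0 t := fun x =>
    intervalIntegrable_kernel_smul hα1 ht le_rfl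
      (x.continuous.Icc_extend'.sub continuous_const).aestronglyMeasurable
      (Eventually.of_forall (norm_extend_sub_le x))
  have hI : 0 ≤ ∫ ξ in (0 : ℝ)..t, ((t - ξ) ^ (1 - (1 - α)))⁻¹ :=
    intervalIntegral.integral_nonneg ht fun ξ hξ => kernel_nonneg hξ.2
  refine (LipschitzWith.of_dist_le_mul (K := Real.toNNReal ((Real.Gamma (1 - α))⁻¹ *
    (2 * ∫ ξ in (0 : ℝ)..t, ((t - ξ) ^ (1 - (1 - α)))⁻¹))) fun x y => ?_).continuous
  rw [dist_eq_norm, dist_eq_norm, rlDefect, rlDefect, rlIntegral_of_pos hα1, rlIntegral_of_pos hα1,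
    ← smul_sub, ← intervalIntegral.integral_sub (hii x) (hii y), norm_smul,
    Real.norm_of_nonneg (inv_nonneg.2 hΓ.le), Real.coe_toNNReal _ (by positivity),
    mul_assoc]
  refine mul_le_mul_of_nonneg_left ?_ (inv_nonneg.2 hΓ.le)
  have e : 2 * (∫ ξ in (0 : ℝ)..t, ((t - ξ) ^ (1 - (1 - α)))⁻¹) * ‖x - y‖ =
      ∫ ξ in (0 : ℝ)..t, ((t - ξ) ^ (1 - (1 - α)))⁻¹ * (2 * ‖x - y‖) := by
    rw [intervalIntegral.integral_mul_const]; ring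
  rw [e]
  refine intervalIntegral.norm_integral_le_of_norm_le ht
    (Eventually.of_forall fun ξ hξ => ?_)
    ((intervalIntegrable_kernel hα1 ht le_rfl).mul_const _)
  rw [← smul_sub, norm_smul, Real.norm_of_nonneg (kernel_nonneg hξ.2)]
  refine mul_le_mul_of_nonneg_left ?_ (kernel_nonneg hξ.2)
  have := norm_extend_sub_le (hT := hT) (x - y) ξ
  refine le_trans (le_of_eq ?_) this
  congr 1
  simp only [IccExtend, Function.comp, ContinuousMap.sub_apply]
  abel

/-- The paths that start at `a` and have a density bounded by `C`, described by a Lipschitz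
condition. -/
def boundedPaths {T : ℝ} (α : ℝ) (hT : 0 ≤ T) (a : Vec n) (C : ℝ) :
    Set C(Icc (0 : ℝ) T, Vec n) :=
  {x | x ⟨0, left_mem_Icc.2 hT⟩ = a ∧
    ∀ s ∈ Icc 0 T, ∀ t ∈ Icc 0 T, ‖rlDefect α hT x s - rlDefect α hT x t‖ ≤ C * |s - t|}

/-- A bound on the density is not visibly stable under uniform limits; the Lipschitz bound on
I^(1−α)(x − x(0)) is, being an intersection of closed conditions. -/
theorem isClosed_boundedPaths {α T : ℝ} (hα : α ∈ Ioo (0 : ℝ) 1) (hT : 0 ≤ T) (a : Vec n)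
    (C : ℝ) : IsClosed (boundedPaths α hT a C) := by
  have : boundedPaths α hT a C = {x | x ⟨0, left_mem_Icc.2 hT⟩ = a} ∩
      ⋂ s ∈ Icc 0 T, ⋂ t ∈ Icc 0 T,
        {x | ‖rlDefect α hT x s - rlDefect α hT x t‖ ≤ C * |s - t|} := by
    ext x
    simp only [boundedPaths, mem_inter_iff, mem_iInter, mem_ofPred_eq]
  rw [this]
  refine IsClosed.inter (isClosed_eq (by fun_prop) continuous_const) <|
    isClosed_biInter fun s hs => isClosed_biInter fun t ht => ?_
  exact isClosed_le ((continuous_rlDefect hα hs.1).sub (continuous_rlDefect hα ht.1)).norm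
    continuous_const

/-- With v = x − x(0), the density ψ is the derivative of the Lipschitz function I^(1−α) v. Then
I^(1−α) v = ∫ ψ = I^(1−α) I^α ψ, and applying I^α to both ends shows that v and I^α ψ have the same
primitive; both are continuous, so they agree. -/
theorem exists_isDensity_of_mem_boundedPaths {α T C : ℝ} (hα : α ∈ Ioo (0 : ℝ) 1) (hT : 0 < T)
    (hC : 0 ≤ C) {a : Vec n} {x : C(Icc (0 : ℝ) T, Vec n)} (hx : x ∈ boundedPaths α hT.le a C) :
    ∃ ψ, IsDensity α hT.le x ψ C := by
  have hα' : 1 - α ∈ Ioo (0 : ℝ) 1 := ⟨sub_pos.2 hα.2, sub_lt_self _ hα.1⟩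
  set F : ℝ → Vec n := IccExtend hT.le fun t : Icc (0 : ℝ) T => rlDefect α hT.le x t with hF
  have hFeq : ∀ t ∈ Icc 0 T, F t = rlDefect α hT.le x t := fun t ht => IccExtend_of_mem _ _ ht
  have hFl : LipschitzWith C.toNNReal F := by
    refine LipschitzWith.of_dist_le_mul fun s t => ?_
    rw [dist_eq_norm, dist_eq_norm, Real.coe_toNNReal C hC]
    refine (hx.2 _ (projIcc 0 T hT.le s).2 _ (projIcc 0 T hT.le t).2).trans ?_
    refine mul_le_mul_of_nonneg_left ?_ hC
    exact abs_projIcc_sub_projIcc hT.le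
  set ψ : ℝ → Vec n := deriv F with hψ
  have hψm : StronglyMeasurable ψ := (measurable_deriv F).stronglyMeasurable
  have hψC : ∀ ξ, ‖ψ ξ‖ ≤ C := fun ξ => by
    simpa only [Real.coe_toNNReal C hC] using norm_deriv_le_of_lipschitz (x₀ := ξ) hFl
  have hloc : LocallyIntegrable ψ volume :=
    (memLp_top_of_bound hψm.aestronglyMeasurable C (Eventually.of_forall hψC)).locallyIntegrable
      le_top
  have hψi : ∀ a b, IntervalIntegrable ψ volume a b := fun a b =>
    intervalIntegrable_iff.2 ((hloc.integrableOn_isCompact isCompact_uIcc).mono_set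
      uIoc_subset_uIcc)
  set P : ℝ → Vec n := fun t => ∫ ξ in (0 : ℝ)..t, ψ ξ with hP
  have hPl : LipschitzWith C.toNNReal P := by
    refine LipschitzWith.of_dist_le_mul fun s t => ?_
    rw [dist_eq_norm, dist_eq_norm, Real.coe_toNNReal C hC, hP]
    simp only
    rw [intervalIntegral.integral_interval_sub_left (hψi _ _) (hψi _ _)]
    exact intervalIntegral.norm_integral_le_of_norm_le_const fun ξ _ => hψC ξ
  have hconst : ∃ c, ∀ t ∈ uIcc 0 T, (F - P) t = c := by
    refine AbsolutelyContinuousOnInterval.const_of_ae_hasDerivAt_zero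
      ((hFl.lipschitzOnWith.absolutelyContinuousOnInterval).sub
        (hPl.lipschitzOnWith.absolutelyContinuousOnInterval)) ?_
    filter_upwards [hFl.ae_differentiableAt_real, LocallyIntegrable.ae_hasDerivAt_integral hloc]
      with t h1 h2 _
    have h3 : HasDerivAt (F - P) (deriv F t - ψ t) t := h1.hasDerivAt.sub (h2 0)
    rwa [hψ, sub_self] at h3
  obtain ⟨c, hc⟩ := hconst
  rw [uIcc_of_le hT.le] at hc
  have hc0 : c = 0 := by
    rw [← hc 0 (left_mem_Icc.2 hT.le), Pi.sub_apply, hFeq 0 (left_mem_Icc.2 hT.le), hP]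
    simp [rlDefect, rlIntegral_zero_right hα'.1]
  have hFP : ∀ t ∈ Icc 0 T, rlDefect α hT.le x t = P t := fun t ht => by
    rw [← hFeq t ht]
    have := hc t ht
    rw [hc0, Pi.sub_apply] at this
    exact sub_eq_zero.1 this
  set v : ℝ → Vec n := fun ξ => IccExtend hT.le x ξ - IccExtend hT.le x 0 with hv
  have hvc : Continuous v := x.continuous.Icc_extend'.sub continuous_const
  have hrc : Continuous fun t : Icc (0 : ℝ) T => rlIntegral α ψ t :=
    continuousOn_iff_continuous_domRestrict.1
      ((continuousOn_rlIntegral hα hψm hψC).mono Icc_subset_Ici_self)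
  let r : C(Icc (0 : ℝ) T, Vec n) := ⟨_, hrc⟩
  have hrext : ∀ ξ ∈ Icc 0 T, IccExtend hT.le r ξ = rlIntegral α ψ ξ := fun ξ hξ =>
    IccExtend_of_mem _ _ hξ
  have hintegral : ∀ τ ∈ Icc 0 T, ∫ ξ in (0 : ℝ)..τ, v ξ = ∫ ξ in (0 : ℝ)..τ, IccExtend hT.le r ξ := by
    intro τ hτ
    rw [← rlIntegral_rlIntegral hα' hτ.1 hvc.stronglyMeasurable (norm_extend_sub_le x),
      ← rlIntegral_rlIntegral hα' hτ.1 r.continuous.Icc_extend'.stronglyMeasurable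
        fun ξ => r.norm_coe_le_norm _, sub_sub_cancel]
    refine rlIntegral_congr hα.1 hτ.1 fun ξ hξ => ?_
    have hξT : ξ ∈ Icc 0 T := ⟨hξ.1, hξ.2.trans hτ.2⟩
    refine (hFP ξ hξT).trans ?_
    refine (rlIntegral_rlIntegral hα hξ.1 hψm hψC).symm.trans ?_
    exact rlIntegral_congr hα'.1 hξ.1 fun ζ hζ => (hrext ζ ⟨hζ.1, hζ.2.trans hξT.2⟩).symm
  have hrc' : Continuous (IccExtend hT.le r) := r.continuous.Icc_extend'
  have hopen : EqOn v (IccExtend hT.le r) (Ioo 0 T) := by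
    intro τ hτ
    rw [← hvc.deriv_integral v 0 τ, ← hrc'.deriv_integral (IccExtend hT.le r) 0 τ]
    refine EventuallyEq.deriv_eq ?_
    filter_upwards [Ioo_mem_nhds hτ.1 hτ.2] with s hs
    exact hintegral s (Ioo_subset_Icc_self hs)
  have hclosed : EqOn v (IccExtend hT.le r) (Icc 0 T) := by
    have := hopen.closure hvc hrc'
    rwa [closure_Ioo hT.ne] at this
  refine ⟨ψ, hψm, hψC, fun τ => ?_⟩
  rw [← hrext τ τ.2, ← hclosed τ.2, hv]
  simp only
  rw [IccExtend_of_mem hT.le _ τ.2, IccExtend_of_mem hT.le _ (left_mem_Icc.2 hT.le),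
    add_sub_cancel]

/-- The Hölder modulus of `IsDensity.norm_sub_le` depends on C and α only, so Arzelà–Ascoli applies
to the closed set. -/
theorem isCompact_boundedPaths {α T C : ℝ} (hα : α ∈ Ioo (0 : ℝ) 1) (hT : 0 < T) (hC : 0 ≤ C)
    (a : Vec n) : IsCompact (boundedPaths α hT.le a C) := by
  have hG := Real.Gamma_pos_of_pos hα.1
  set L := 2 * C / (α * Real.Gamma α) with hL
  have hL0 : 0 ≤ L := div_nonneg (by positivity) (mul_pos hα.1 hG).le
  have hmod : ∀ x ∈ boundedPaths α hT.le a C, ∀ s t : Icc (0 : ℝ) T,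
      ‖x s - x t‖ ≤ L * |(s : ℝ) - t| ^ α := fun x hx s t => by
    obtain ⟨ψ, hψ⟩ := exists_isDensity_of_mem_boundedPaths hα hT hC hx
    exact hψ.norm_sub_le hα s t
  let e := ContinuousMap.isometryEquivBoundedOfCompact (Icc (0 : ℝ) T) (Vec n)
  have hcomp : IsCompact (e.symm ⁻¹' boundedPaths α hT.le a C) := by
    refine BoundedContinuousFunction.arzela_ascoli₂ (Metric.closedBall a (L * T ^ α))
      (isCompact_closedBall _ _) _ ((isClosed_boundedPaths hα hT.le a C).preimage
        e.symm.continuous) ?_ ?_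
    · intro f t hf
      have h1 := hmod _ hf t ⟨0, left_mem_Icc.2 hT.le⟩
      rw [hf.1] at h1
      rw [mem_closedBall_iff_norm]
      refine h1.trans (mul_le_mul_of_nonneg_left ?_ hL0)
      rw [sub_zero, abs_of_nonneg t.2.1]
      exact Real.rpow_le_rpow t.2.1 t.2.2 hα.1.le
    · refine Metric.equicontinuous_of_continuity_modulus (fun r => L * |r| ^ α) ?_ _ ?_
      · have : Continuous fun r : ℝ => L * |r| ^ α :=
          continuous_const.mul (continuous_abs.rpow_const fun _ => Or.inr hα.1.le)
        have h2 := this.tendsto 0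
        simpa only [abs_zero, Real.zero_rpow hα.1.ne', mul_zero] using h2
      · intro s t f
        rw [dist_eq_norm, abs_of_nonneg dist_nonneg, Subtype.dist_eq, Real.dist_eq]
        exact hmod _ f.2 s t
  have := hcomp.image e.symm.continuous
  rwa [image_preimage_eq _ e.symm.surjective] at this

theorem mem_boundedPaths_of_caputo {α T C : ℝ} (hα : α ∈ Ioo (0 : ℝ) 1) {hT : 0 ≤ T}
    {x : C(Icc (0 : ℝ) T, Vec n)} (hx : x ∈ AC n α hT)
    (hC : ∀ᵐ t ∂volume.restrict (Icc 0 T), ‖caputo α hT x t‖ ≤ C) :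
    x ∈ boundedPaths α hT (x ⟨0, left_mem_Icc.2 hT⟩) C := by
  obtain ⟨ψ, C', h⟩ := exists_isDensity hα.1 hx
  refine ⟨rfl, fun s hs t ht => ?_⟩
  have hψi : ∀ a b, IntervalIntegrable ψ volume a b := fun a b =>
    (intervalIntegrable_const (c := C')).mono_fun' h.1.aestronglyMeasurable
      (Eventually.of_forall h.2)
  rw [rlDefect, rlDefect, h.rlIntegral_extend_sub hα hs, h.rlIntegral_extend_sub hα ht,
    intervalIntegral.integral_interval_sub_left (hψi _ _) (hψi _ _)]
  refine intervalIntegral.norm_integral_le_of_norm_le_const_ae ?_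
  have h1 := (ae_restrict_iff' measurableSet_Icc).1 hC
  have h2 := (ae_restrict_iff' measurableSet_Icc).1 (h.caputo_ae_eq hα)
  filter_upwards [h1, h2] with ξ h3 h4 hξ
  have hm : ξ ∈ Icc 0 T := uIcc_subset_Icc ht hs (uIoc_subset_uIcc hξ)
  rw [← h4 hm]
  exact h3 hm

end

/-! ### A priori bounds for continuations of a path. -/

section

variable {n : ℕ}

/-! ### A priori bounds -/

/-- Substitute r = τ − ξ and extend the integral to the half-line. The factor M^(−α) shows that the
fractional integral becomes small in exponentially weighted norms. -/
theorem integral_kernel_mul_exp_le {α M τ : ℝ} (hα : 0 < α) (hM : 0 < M) (hτ : 0 ≤ τ) :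
    (Real.Gamma α)⁻¹ * ∫ ξ in (0 : ℝ)..τ, ((τ - ξ) ^ (1 - α))⁻¹ * Real.exp (M * ξ) ≤
      Real.exp (M * τ) * (1 / M) ^ α := by
  have hG := Real.Gamma_pos_of_pos hα
  have hI := Real.integral_rpow_mul_exp_neg_mul_Ioi hα hM
  have hintegral : IntegrableOn (fun r : ℝ => r ^ (α - 1) * Real.exp (-(M * r))) (Ioi 0) := by
    refine Integrable.of_integral_ne_zero (hI.trans_ne ?_)
    positivity
  have h1 : ∫ ξ in (0 : ℝ)..τ, ((τ - ξ) ^ (1 - α))⁻¹ * Real.exp (M * ξ) =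
      Real.exp (M * τ) * ∫ r in (0 : ℝ)..τ, r ^ (α - 1) * Real.exp (-(M * r)) := by
    have h2 := intervalIntegral.integral_comp_sub_left (a := 0) (b := τ)
      (fun r : ℝ => r ^ (α - 1) * Real.exp (-(M * r))) τ
    rw [sub_self, sub_zero] at h2
    rw [← h2, ← intervalIntegral.integral_const_mul]
    refine intervalIntegral.integral_congr fun ξ hξ => ?_
    rw [uIcc_of_le hτ] at hξ
    rw [inv_rpow_one_sub (sub_nonneg.2 hξ.2), mul_left_comm, ← Real.exp_add]
    congr 2
    ring
  have h3 : ∫ r in (0 : ℝ)..τ, r ^ (α - 1) * Real.exp (-(M * r)) ≤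
      (1 / M) ^ α * Real.Gamma α := by
    rw [← hI, intervalIntegral.integral_of_le hτ]
    refine setIntegral_mono_set hintegral ?_ (Ioc_subset_Ioi_self.eventuallyLE)
    filter_upwards [ae_restrict_mem measurableSet_Ioi] with r (hr : 0 < r)
    simp only [Pi.zero_apply]
    positivity
  rw [h1]
  calc _ ≤ (Real.Gamma α)⁻¹ * (Real.exp (M * τ) * ((1 / M) ^ α * Real.Gamma α)) := by gcongr
    _ = _ := by field_simp

/-- The paths that continue `g` and satisfy `‖ᶜD^α x‖ ≤ c (1 + ‖x‖)` almost everywhere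
afterwards. -/
def continuations {α T : ℝ} (hT : 0 ≤ T) (c : ℝ) (g : G n α T) : Set (AC n α hT) :=
  {x | (∀ τ ∈ Icc 0 g.1.time, IccExtend hT x.1 τ = IccExtend g.1.time_nonneg g.1.path τ) ∧
    ∀ᵐ t ∂volume.restrict (Icc g.1.time T),
      ‖caputo α hT x.1 t‖ ≤ c * (1 + ‖IccExtend hT x.1 t‖)}

theorem ae_restrict_Icc_of_split {a b c : ℝ} {p : ℝ → Prop}
    (h₁ : ∀ᵐ t ∂volume.restrict (Icc a b), p t) (h₂ : ∀ᵐ t ∂volume.restrict (Icc b c), p t) :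
    ∀ᵐ t ∂volume.restrict (Icc a c), p t := by
  rw [ae_restrict_iff' measurableSet_Icc] at *
  filter_upwards [h₁, h₂] with t h3 h4 ht
  rcases le_total t b with h | h
  · exact h3 ⟨ht.1, h⟩
  · exact h4 ⟨h, ht.2⟩

/-- A Gronwall type inequality for the Caputo derivative. -/
theorem norm_le_of_caputo_le {α T A c : ℝ} (hα : α ∈ Ioo (0 : ℝ) 1) {hT : 0 ≤ T} (hA : 0 ≤ A)
    (hc : 0 < c) {x : C(Icc (0 : ℝ) T, Vec n)} (hx : x ∈ AC n α hT)
    (h : ∀ᵐ t ∂volume.restrict (Icc 0 T), ‖caputo α hT x t‖ ≤ A + c * ‖IccExtend hT x t‖)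
    (t : Icc (0 : ℝ) T) :
    ‖x t‖ ≤ 2 * (‖x ⟨0, left_mem_Icc.2 hT⟩‖ + A * T ^ α / (α * Real.Gamma α)) *
      Real.exp ((2 * c) ^ (1 / α) * T) := by
  obtain ⟨ψ, C', hψ⟩ := exists_isDensity hα.1 hx
  have hG := Real.Gamma_pos_of_pos hα.1
  -- Chosen so that c M^(−α) = 1/2: at the maximum point of e^(−Mt) ‖x(t)‖ the integral term is at
  -- most half of the maximum and is absorbed.
  set M := (2 * c) ^ (1 / α) with hM
  have hM0 : 0 < M := Real.rpow_pos_of_pos (by positivity) _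
  have hMα : c * (1 / M) ^ α = 1 / 2 := by
    rw [hM, Real.div_rpow zero_le_one (by positivity), Real.one_rpow,
      ← Real.rpow_mul (by positivity), one_div_mul_cancel hα.1.ne', Real.rpow_one]
    field_simp
  have hne : Nonempty (Icc (0 : ℝ) T) := ⟨⟨0, left_mem_Icc.2 hT⟩⟩
  obtain ⟨τ, -, hτ⟩ := isCompact_univ.exists_isMaxOn (univ_nonempty (α := Icc (0 : ℝ) T))
    (f := fun τ : Icc (0 : ℝ) T => Real.exp (-(M * τ)) * ‖x τ‖)
    (Continuous.continuousOn (by fun_prop))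
  set m := Real.exp (-(M * τ)) * ‖x τ‖ with hm
  have hm0 : 0 ≤ m := by positivity
  have hxm : ∀ s : Icc (0 : ℝ) T, ‖x s‖ ≤ m * Real.exp (M * s) := fun s => by
    have h1 : Real.exp (-(M * s)) * ‖x s‖ ≤ m := hτ (mem_univ s)
    calc ‖x s‖ = Real.exp (-(M * s)) * ‖x s‖ * Real.exp (M * s) := by
          rw [mul_right_comm, ← Real.exp_add, neg_add_cancel, Real.exp_zero, one_mul]
      _ ≤ _ := by gcongr
  have hψle : ∀ᵐ ξ, ξ ∈ Ioc 0 (τ : ℝ) → ‖((τ - ξ : ℝ) ^ (1 - α))⁻¹ • ψ ξ‖ ≤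
      A * ((τ - ξ : ℝ) ^ (1 - α))⁻¹ +
        c * m * (((τ - ξ : ℝ) ^ (1 - α))⁻¹ * Real.exp (M * ξ)) := by
    have h1 := (ae_restrict_iff' measurableSet_Icc).1 h
    have h2 := (ae_restrict_iff' measurableSet_Icc).1 (hψ.caputo_ae_eq hα)
    filter_upwards [h1, h2] with ξ h3 h4 hξ
    have hξT : ξ ∈ Icc 0 T := ⟨hξ.1.le, hξ.2.trans τ.2.2⟩
    have h5 := h3 hξT
    rw [h4 hξT, IccExtend_of_mem hT _ hξT] at h5
    have h6 : ‖ψ ξ‖ ≤ A + c * (m * Real.exp (M * ξ)) := by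
      have := hxm ⟨ξ, hξT⟩
      exact h5.trans (by gcongr)
    have hk := kernel_nonneg (α := α) hξ.2
    rw [norm_smul, Real.norm_of_nonneg hk]
    calc _ ≤ ((τ - ξ : ℝ) ^ (1 - α))⁻¹ * (A + c * (m * Real.exp (M * ξ))) := by gcongr
      _ = _ := by ring
  have hk1 := intervalIntegrable_kernel (α := α) hα.1 τ.2.1 le_rfl
  have hk2 : IntervalIntegrable (fun ξ : ℝ => ((τ - ξ : ℝ) ^ (1 - α))⁻¹ * Real.exp (M * ξ))
      volume 0 τ := hk1.mul_continuousOn (Continuous.continuousOn (by fun_prop))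
  have hrl : ‖rlIntegral α ψ τ‖ ≤ A * T ^ α / (α * Real.Gamma α) + m / 2 * Real.exp (M * τ) := by
    rw [rlIntegral_of_pos hα.1, norm_smul, Real.norm_of_nonneg (inv_nonneg.2 hG.le)]
    have h7 := intervalIntegral.norm_integral_le_of_norm_le τ.2.1 hψle
      ((hk1.const_mul A).add (hk2.const_mul (c * m)))
    rw [intervalIntegral.integral_add (hk1.const_mul A) (hk2.const_mul (c * m)),
      intervalIntegral.integral_const_mul, intervalIntegral.integral_const_mul,
      integral_kernel hα.1 τ.2.1 le_rfl, sub_zero, sub_self, Real.zero_rpow hα.1.ne',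
      sub_zero] at h7
    have h8 := integral_kernel_mul_exp_le hα.1 hM0 τ.2.1
    have h9 : (τ : ℝ) ^ α ≤ T ^ α := Real.rpow_le_rpow τ.2.1 τ.2.2 hα.1.le
    have hα0 := hα.1
    calc _ ≤ (Real.Gamma α)⁻¹ * (A * ((τ : ℝ) ^ α / α) + c * m *
            ∫ ξ in (0 : ℝ)..τ, ((τ - ξ : ℝ) ^ (1 - α))⁻¹ * Real.exp (M * ξ)) := by gcongr
      _ = A * (τ : ℝ) ^ α / (α * Real.Gamma α) + c * m * ((Real.Gamma α)⁻¹ *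
            ∫ ξ in (0 : ℝ)..τ, ((τ - ξ : ℝ) ^ (1 - α))⁻¹ * Real.exp (M * ξ)) := by
          generalize (∫ ξ in (0 : ℝ)..τ, ((τ - ξ : ℝ) ^ (1 - α))⁻¹ * Real.exp (M * ξ)) = I
          field_simp
      _ ≤ A * T ^ α / (α * Real.Gamma α) +
            c * m * (Real.exp (M * τ) * (1 / M) ^ α) := by gcongr
      _ = A * T ^ α / (α * Real.Gamma α) + (c * (1 / M) ^ α) * m * Real.exp (M * τ) := by ring
      _ = _ := by rw [hMα]; ring
  set B := ‖x ⟨0, left_mem_Icc.2 hT⟩‖ + A * T ^ α / (α * Real.Gamma α) with hB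
  have hB0 : 0 ≤ B := by
    have := hα.1
    positivity
  have hmB : m ≤ 2 * B := by
    have h1 : ‖x τ‖ ≤ B + m / 2 * Real.exp (M * τ) := by
      rw [hψ.3 τ]
      refine (norm_add_le _ _).trans ?_
      linarith
    have h2 : m ≤ Real.exp (-(M * τ)) * (B + m / 2 * Real.exp (M * τ)) := by
      rw [hm]; gcongr
    have h3 : Real.exp (-(M * τ)) * Real.exp (M * τ) = 1 := by
      rw [← Real.exp_add, neg_add_cancel, Real.exp_zero]
    have h4 : Real.exp (-(M * (τ : ℝ))) ≤ 1 := by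
      rw [Real.exp_le_one_iff, neg_nonpos]
      exact mul_nonneg hM0.le τ.2.1
    have h5 : Real.exp (-(M * τ)) * (B + m / 2 * Real.exp (M * τ)) =
        Real.exp (-(M * τ)) * B + m / 2 := by linear_combination (m / 2) * h3
    have h6 : Real.exp (-(M * (τ : ℝ))) * B ≤ B := mul_le_of_le_one_left hB0 h4
    linarith
  refine (hxm t).trans ?_
  have := t.2.2
  gcongr

/-- Up to the time of `g` the derivative is bounded through the density of `g`, afterwards by the
growth condition. The sum of both bounds holds on all of [0, T], so the Gronwall inequality can
start at time 0, as the memory of the derivative requires. `R` and `C` serve all continuations at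
once. -/
theorem exists_bound_continuations {α T c : ℝ} (hα : α ∈ Ioo (0 : ℝ) 1) (hT : 0 ≤ T)
    (hc : 0 < c) (g : G n α T) : ∃ R C : ℝ, 0 ≤ R ∧ 0 ≤ C ∧ ∀ x ∈ continuations hT c g,
      (∀ t, ‖IccExtend hT x.1 t‖ ≤ R) ∧
      ∀ᵐ t ∂volume.restrict (Icc 0 T), ‖caputo α hT x.1 t‖ ≤ C := by
  obtain ⟨ψ, C₀, hψ⟩ := exists_isDensity (hT := g.1.time_nonneg) hα.1 g.2
  have hC₀ : 0 ≤ C₀ := (norm_nonneg _).trans (hψ.2 0)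
  have hG := Real.Gamma_pos_of_pos hα.1
  have hα0 := hα.1
  set a := g.1.path ⟨0, left_mem_Icc.2 g.1.time_nonneg⟩ with ha
  set R := 2 * (‖a‖ + (C₀ + c) * T ^ α / (α * Real.Gamma α)) *
      Real.exp ((2 * c) ^ (1 / α) * T) with hR
  have hR0 : 0 ≤ R := by positivity
  refine ⟨R, C₀ + c + c * R, hR0, by positivity, fun x hx => ?_⟩
  have h1 : ∀ᵐ t ∂volume.restrict (Icc 0 T),
      ‖caputo α hT x.1 t‖ ≤ C₀ + c + c * ‖IccExtend hT x.1 t‖ := by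
    refine ae_restrict_Icc_of_split (b := g.1.time) ?_ ?_
    · have h2 := hψ.caputo_ae_eq hα
      rw [← Measure.restrict_congr_set (Ioo_ae_eq_Icc (a := (0 : ℝ)) (b := g.1.time))] at h2 ⊢
      filter_upwards [h2, ae_restrict_mem measurableSet_Ioo] with t h3 ht
      rw [caputo_congr hα hx.1 ht, h3]
      have := hψ.2 t
      have : 0 ≤ c * ‖IccExtend hT x.1 t‖ := by positivity
      linarith
    · filter_upwards [hx.2] with t ht
      linarith
  have hx0 : x.1 ⟨0, left_mem_Icc.2 hT⟩ = a := by
    have := hx.1 0 (left_mem_Icc.2 g.1.time_nonneg)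
    rwa [IccExtend_of_mem hT _ (left_mem_Icc.2 hT),
      IccExtend_of_mem _ _ (left_mem_Icc.2 g.1.time_nonneg)] at this
  have h4 : ∀ t, ‖IccExtend hT x.1 t‖ ≤ R := fun t => by
    have := norm_le_of_caputo_le hα (by positivity) hc x.2 h1 (projIcc 0 T hT t)
    rwa [hx0] at this
  refine ⟨h4, ?_⟩
  filter_upwards [h1] with t ht
  have := h4 t
  exact ht.trans (by gcongr)

end

/-! ### Characteristics steered by the extremal feedback. -/

section

variable {n : ℕ} {α T : ℝ}

/-! ### Continuations of paths and characteristics -/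

theorem extend_trunc {hT : 0 ≤ T} (x : AC n α hT) (t : Icc (0 : ℝ) T) {τ : ℝ}
    (hτ : τ ∈ Icc 0 (t : ℝ)) :
    IccExtend (trunc x t).1.time_nonneg (trunc x t).1.path τ = IccExtend hT x.1 τ := by
  rw [IccExtend_of_mem hT _ (⟨hτ.1, hτ.2.trans t.2.2⟩ : τ ∈ Icc 0 T)]
  exact IccExtend_of_mem (trunc x t).1.time_nonneg _ hτ

theorem trunc_eq_of_mem_continuations {hT : 0 ≤ T} {c : ℝ} {g : G n α T} {x : AC n α hT}
    (hx : x ∈ continuations hT c g) :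
    trunc x ⟨g.1.time, g.1.time_nonneg, g.1.time_le⟩ = g := by
  obtain ⟨⟨t, h0, h1, w⟩, hg⟩ := g
  refine Subtype.ext ?_
  simp only [trunc, PathPoint.restr, PathPoint.mk.injEq, heq_eq_eq, true_and]
  ext1 τ
  have := hx.1 τ τ.2
  rw [IccExtend_of_mem hT _ (⟨τ.2.1, τ.2.2.trans h1⟩ : (τ : ℝ) ∈ Icc 0 T)] at this
  exact this.trans (IccExtend_of_mem h0 _ τ.2)

theorem trunc_eq_terminal {hT : 0 ≤ T} (x : AC n α hT) :
    trunc x ⟨T, right_mem_Icc.2 hT⟩ = terminal x :=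
  rfl

theorem mem_continuations_of_mem_CH {hT : 0 ≤ T} {H : ℝ → Vec n → Vec n → ℝ} {cH z₀ : ℝ}
    {g : G n α T} {s : Vec n} {p : AC n α hT × (ℝ → ℝ)} (hp : p ∈ CH hT H cH g z₀ s) :
    p.1 ∈ continuations hT cH g := by
  refine ⟨fun τ hτ => ?_, ?_⟩
  · rw [IccExtend_of_mem hT _ (⟨hτ.1, hτ.2.trans g.1.time_le⟩ : τ ∈ Icc 0 T),
      IccExtend_of_mem _ _ hτ]
    exact hp.2.1 ⟨τ, hτ⟩
  · filter_upwards [hp.2.2.2] with t ht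
    exact ht.1

/-- Before t the Caputo derivative of x' sees only the common past with x, so the inequality for x
carries over there. -/
theorem continuations_trans (hα : α ∈ Ioo (0 : ℝ) 1) {hT : 0 ≤ T} {c : ℝ} {g : G n α T}
    {x x' : AC n α hT} {t : Icc (0 : ℝ) T} (hx : x ∈ continuations hT c g)
    (hgt : g.1.time ≤ t) (hx' : x' ∈ continuations hT c (trunc x t)) :
    x' ∈ continuations hT c g := by
  have hagree : ∀ τ ∈ Icc 0 (t : ℝ), IccExtend hT x'.1 τ = IccExtend hT x.1 τ := fun τ hτ =>
    (hx'.1 τ hτ).trans (extend_trunc x t hτ)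
  refine ⟨fun τ hτ => (hagree τ ⟨hτ.1, hτ.2.trans hgt⟩).trans (hx.1 τ hτ), ?_⟩
  refine ae_restrict_Icc_of_split (b := t) ?_ hx'.2
  have h1 := ae_restrict_of_ae_restrict_of_subset (Icc_subset_Icc_right t.2.2) hx.2
  rw [← Measure.restrict_congr_set (Ioo_ae_eq_Icc (a := g.1.time) (b := (t : ℝ)))] at h1 ⊢
  filter_upwards [h1, ae_restrict_mem measurableSet_Ioo] with τ h2 hτ
  have h0 : 0 < τ := g.1.time_nonneg.trans_lt hτ.1
  rwa [caputo_congr hα hagree ⟨h0, hτ.2⟩, hagree τ ⟨h0.le, hτ.2.le⟩]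

/-! ### The feedback and the accumulated penalty -/

/-- The extremal feedback `s(t) = -k e^(-2μt) (x(t) - y(t))`. -/
noncomputable def feedback (k μ : ℝ) (hT : 0 ≤ T) (x y : C(Icc (0 : ℝ) T, Vec n)) (t : ℝ) :
    Vec n :=
  (-(k * Real.exp (-(2 * μ * t)))) • (IccExtend hT x t - IccExtend hT y t)

/-- The bound for the rate of growth of the difference of two characteristics under the
feedback. -/
noncomputable def growth (α k μ lam : ℝ) (hT : 0 ≤ T) (x y : C(Icc (0 : ℝ) T, Vec n)) (t : ℝ) :
    ℝ :=
  inner ℝ (feedback k μ hT x y t) (caputo α hT x t - caputo α hT y t) +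
    lam * (1 + ‖feedback k μ hT x y t‖) * ‖IccExtend hT x t - IccExtend hT y t‖

theorem continuous_extend {hT : 0 ≤ T} (x : C(Icc (0 : ℝ) T, Vec n)) :
    Continuous (IccExtend hT x) :=
  x.continuous.Icc_extend'

theorem continuous_feedback (k μ : ℝ) {hT : 0 ≤ T} (x y : C(Icc (0 : ℝ) T, Vec n)) :
    Continuous (feedback k μ hT x y) :=
  (by fun_prop : Continuous fun t => -(k * Real.exp (-(2 * μ * t)))).smul
    ((continuous_extend x).sub (continuous_extend y))

theorem intervalIntegrable_inner_of_bounded {C a b : ℝ} {f ψ : ℝ → Vec n} (hf : Continuous f)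
    (hψ : StronglyMeasurable ψ) (hC : ∀ ξ, ‖ψ ξ‖ ≤ C) :
    IntervalIntegrable (fun t => inner ℝ (f t) (ψ t)) volume a b := by
  refine ((hf.norm.intervalIntegrable a b).mul_const C).mono_fun'
    (hf.stronglyMeasurable.inner hψ).aestronglyMeasurable (Eventually.of_forall fun t => ?_)
  exact (norm_inner_le_norm _ _).trans (mul_le_mul_of_nonneg_left (hC t) (norm_nonneg _))

theorem intervalIntegrable_growth (hα : α ∈ Ioo (0 : ℝ) 1) (k μ lam : ℝ) {hT : 0 ≤ T}
    {x y : C(Icc (0 : ℝ) T, Vec n)} (hx : x ∈ AC n α hT) (hy : y ∈ AC n α hT) {a b : ℝ}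
    (ha : a ∈ Icc 0 T) (hb : b ∈ Icc 0 T) :
    IntervalIntegrable (growth α k μ lam hT x y) volume a b := by
  obtain ⟨ψ, C, hψ⟩ := exists_isDensity hα.1 hx
  obtain ⟨ψ', C', hψ'⟩ := exists_isDensity hα.1 hy
  have hs := continuous_feedback k μ (hT := hT) x y
  have hw := (continuous_extend (hT := hT) x).sub (continuous_extend (hT := hT) y)
  have h1 : IntervalIntegrable (fun t => inner ℝ (feedback k μ hT x y t) (ψ t - ψ' t) +
      lam * (1 + ‖feedback k μ hT x y t‖) * ‖IccExtend hT x t - IccExtend hT y t‖)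
      volume a b := by
    refine (intervalIntegrable_inner_of_bounded (C := C + C') hs (hψ.1.sub hψ'.1)
      fun ξ => (norm_sub_le _ _).trans (add_le_add (hψ.2 ξ) (hψ'.2 ξ))).add ?_
    exact ((continuous_const.mul (continuous_const.add hs.norm)).mul hw.norm).intervalIntegrable _ _
  refine h1.congr_ae ?_
  have hsub : uIoc a b ⊆ Icc 0 T := uIoc_subset_uIcc.trans (uIcc_subset_Icc ha hb)
  filter_upwards [ae_restrict_of_ae_restrict_of_subset hsub (hψ.caputo_ae_eq hα),
    ae_restrict_of_ae_restrict_of_subset hsub (hψ'.caputo_ae_eq hα)] with t h2 h3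
  rw [growth, h2, h3]

theorem exp_neg_sub_le {a b : ℝ} (ha : 0 ≤ a) (hb : 0 ≤ b) :
    |Real.exp (-a) - Real.exp (-b)| ≤ |a - b| := by
  wlog h : a ≤ b generalizing a b
  · rw [abs_sub_comm, abs_sub_comm a]
    exact this hb ha (le_of_not_ge h)
  have h1 : Real.exp (-b) ≤ Real.exp (-a) := Real.exp_le_exp.2 (by linarith)
  rw [abs_of_nonneg (sub_nonneg.2 h1), abs_sub_comm, abs_of_nonneg (sub_nonneg.2 h)]
  have h2 : Real.exp (-b) = Real.exp (-a) * Real.exp (-(b - a)) := by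
    rw [← Real.exp_add]; congr 1; ring
  have h3 := Real.add_one_le_exp (-(b - a))
  have h4 : Real.exp (-a) ≤ 1 := by rw [Real.exp_le_one_iff]; linarith
  have h5 := Real.exp_pos (-a)
  nlinarith

/-- The feedback is equicontinuous along paths with bounded Caputo derivatives. -/
theorem exists_delta_feedback (hα : α ∈ Ioo (0 : ℝ) 1) (hT : 0 < T) {k μ R C L η : ℝ}
    (hk : 0 ≤ k) (hμ : 0 ≤ μ) (hC : 0 ≤ C) (hL : 0 ≤ L) (hη : 0 < η)
    (A : Set (AC n α hT.le))
    (hA : ∀ x ∈ A, (∀ t, ‖IccExtend hT.le x.1 t‖ ≤ R) ∧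
      ∀ᵐ t ∂volume.restrict (Icc 0 T), ‖caputo α hT.le x.1 t‖ ≤ C) :
    ∃ δ > 0, ∀ x ∈ A, ∀ y ∈ A, ∀ s ∈ Icc 0 T, ∀ t ∈ Icc 0 T, |s - t| ≤ δ →
      ‖feedback k μ hT.le x.1 y.1 s - feedback k μ hT.le x.1 y.1 t‖ * L ≤ η := by
  have hG := Real.Gamma_pos_of_pos hα.1
  set D := 2 * C / (α * Real.Gamma α) with hD
  have hD0 : 0 ≤ D := div_nonneg (by positivity) (mul_pos hα.1 hG).le
  have hcont : Continuous fun r : ℝ =>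
      k * (2 * μ * |r| * (2 * R) + 2 * D * |r| ^ α) * L := by
    have : Continuous fun r : ℝ => |r| ^ α := continuous_abs.rpow_const fun _ => Or.inr hα.1.le
    fun_prop
  have hlim := hcont.tendsto 0
  simp only [abs_zero, Real.zero_rpow hα.1.ne', mul_zero, zero_mul, add_zero] at hlim
  obtain ⟨δ, hδ, hball⟩ := Metric.eventually_nhds_iff.1 (hlim.eventually (gt_mem_nhds hη))
  refine ⟨δ / 2, half_pos hδ, fun x hx y hy s hs t ht hst => ?_⟩
  have hlt := hball (y := s - t) (by rw [dist_zero_right, Real.norm_eq_abs]; linarith)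
  refine le_trans (mul_le_mul_of_nonneg_right ?_ hL) hlt.le
  have hmod : ∀ z ∈ A, ‖IccExtend hT.le z.1 s - IccExtend hT.le z.1 t‖ ≤ D * |s - t| ^ α := by
    intro z hz
    obtain ⟨ψ, hψ⟩ := exists_isDensity_of_mem_boundedPaths hα hT hC
      (mem_boundedPaths_of_caputo hα z.2 (hA z hz).2)
    rw [IccExtend_of_mem _ _ hs, IccExtend_of_mem _ _ ht]
    exact hψ.norm_sub_le hα ⟨s, hs⟩ ⟨t, ht⟩
  set X := IccExtend hT.le x.1
  set Y := IccExtend hT.le y.1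
  set e := fun t : ℝ => Real.exp (-(2 * μ * t)) with he
  have hsplit : feedback k μ hT.le x.1 y.1 s - feedback k μ hT.le x.1 y.1 t =
      (-k) • ((e s - e t) • (X s - Y s) + e t • ((X s - X t) - (Y s - Y t))) := by
    simp only [feedback, he]
    module
  rw [hsplit, norm_smul, norm_neg, Real.norm_of_nonneg hk]
  refine mul_le_mul_of_nonneg_left ((norm_add_le _ _).trans (add_le_add ?_ ?_)) hk
  · rw [norm_smul, Real.norm_eq_abs]
    refine mul_le_mul ?_ ?_ (norm_nonneg _) (by positivity)
    · refine (exp_neg_sub_le (by have := hs.1; positivity) (by have := ht.1; positivity)).trans ?_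
      rw [← mul_sub, abs_mul, abs_of_nonneg (by positivity : 0 ≤ 2 * μ)]
    · refine (norm_sub_le _ _).trans ?_
      rw [two_mul]
      exact add_le_add ((hA x hx).1 s) ((hA y hy).1 s)
  · have het : e t ≤ 1 := by
      simp only [he]
      rw [Real.exp_le_one_iff, neg_nonpos]
      have := ht.1
      positivity
    rw [norm_smul, Real.norm_of_nonneg (Real.exp_pos _).le]
    calc _ ≤ 1 * (D * |s - t| ^ α + D * |s - t| ^ α) :=
          mul_le_mul het ((norm_sub_le _ _).trans (add_le_add (hmod x hx) (hmod y hy)))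
            (norm_nonneg _) zero_le_one
      _ = _ := by ring

theorem feedback_congr (k μ : ℝ) {hT : 0 ≤ T} {x x' y y' : C(Icc (0 : ℝ) T, Vec n)} {t : ℝ}
    (hx : IccExtend hT x' t = IccExtend hT x t) (hy : IccExtend hT y' t = IccExtend hT y t) :
    feedback k μ hT x' y' t = feedback k μ hT x y t := by
  rw [feedback, feedback, hx, hy]

/-- The increment of the second component of a characteristic. -/
theorem CH_integral_deriv {hT : 0 ≤ T} {H : ℝ → Vec n → Vec n → ℝ} {cH : ℝ}
    {g : G n α T} {s : Vec n} {p : AC n α hT × (ℝ → ℝ)} (hp : p ∈ CH hT H cH g 0 s) {b : ℝ}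
    (hb : b ∈ Icc g.1.time T) :
    IntervalIntegrable (deriv p.2) volume g.1.time b ∧
      p.2 b = ∫ t in g.1.time..b, deriv p.2 t := by
  obtain ⟨K, hK⟩ := hp.1
  have hsub : uIcc g.1.time b ⊆ Icc 0 T := by
    rw [uIcc_of_le hb.1]
    exact Icc_subset_Icc g.1.time_nonneg hb.2
  have hac := (hK.mono hsub).absolutelyContinuousOnInterval
  refine ⟨hac.intervalIntegrable_deriv, ?_⟩
  rw [hac.integral_deriv_eq_sub, hp.2.2.1 _ (right_mem_Icc.2 g.1.time_nonneg), sub_zero]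

/-- The price of freezing: s₀ is the frozen vector, s the current feedback. Exchanging them costs at
most ‖s₀ − s‖ D in the inner product and ‖s₀ − s‖ lam W in the Lipschitz term. -/
theorem inner_sub_le_of_feedback {n : ℕ} {s s₀ d w : Vec n} {lam h D W η : ℝ} (hlam : 0 ≤ lam)
    (hh : |h| ≤ lam * (1 + ‖s₀‖) * ‖w‖) (hd : ‖d‖ ≤ D) (hw : ‖w‖ ≤ W)
    (hs : ‖s₀ - s‖ * (D + lam * W) ≤ η) :
    inner ℝ s₀ d - h ≤ inner ℝ s d + lam * (1 + ‖s‖) * ‖w‖ + η := by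
  have h1 : inner ℝ s₀ d = inner ℝ s d + inner ℝ (s₀ - s) d := by
    rw [← inner_add_left, add_sub_cancel]
  have h2 : inner ℝ (s₀ - s) d ≤ ‖s₀ - s‖ * D :=
    (real_inner_le_norm _ _).trans (mul_le_mul_of_nonneg_left hd (norm_nonneg _))
  have h3 : ‖s₀‖ ≤ ‖s‖ + ‖s₀ - s‖ := by
    have := norm_add_le s (s₀ - s)
    rwa [add_sub_cancel] at this
  have h4 : lam * (1 + ‖s₀‖) * ‖w‖ ≤ lam * (1 + ‖s‖) * ‖w‖ + ‖s₀ - s‖ * (lam * W) := by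
    calc _ ≤ lam * (1 + (‖s‖ + ‖s₀ - s‖)) * ‖w‖ := by gcongr
      _ = lam * (1 + ‖s‖) * ‖w‖ + ‖s₀ - s‖ * (lam * ‖w‖) := by ring
      _ ≤ _ := by gcongr
  have h5 := neg_le_abs h
  linarith

/-! ### Pairs of characteristics of an upper and a lower solution -/

/-- The same frozen s₀ enters both stability properties, so the Hamiltonian appears only through
H(t, x', s₀) − H(t, y', s₀), which the Lipschitz condition in the state controls. The new paths
agree with the old ones up to a, hence their feedback at a is still s₀. -/
theorem exists_step (hα : α ∈ Ioo (0 : ℝ) 1) {hT : 0 ≤ T} {H : ℝ → Vec n → Vec n → ℝ}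
    {cH : ℝ} {σ : AC n α hT → ℝ} {φpos φneg : G n α T → ℝ}
    (hpos : IsUpperSolution hT H cH σ φpos) (hneg : IsLowerSolution hT H cH σ φneg)
    {g : G n α T} {R C lam : ℝ} (hlam : 0 ≤ lam)
    (hbound : ∀ x ∈ continuations hT cH g, (∀ t, ‖IccExtend hT x.1 t‖ ≤ R) ∧
      ∀ᵐ t ∂volume.restrict (Icc 0 T), ‖caputo α hT x.1 t‖ ≤ C)
    (hH : ∀ t ∈ Icc 0 T, ∀ x x' s : Vec n, ‖x‖ ≤ R → ‖x'‖ ≤ R →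
      |H t x s - H t x' s| ≤ lam * (1 + ‖s‖) * ‖x - x'‖)
    {k μ η ε : ℝ} {a b : Icc (0 : ℝ) T} (hga : g.1.time ≤ a) (hab : (a : ℝ) < b)
    (hmesh : ∀ x ∈ continuations hT cH g, ∀ y ∈ continuations hT cH g, ∀ t ∈ Icc (a : ℝ) b,
      ‖feedback k μ hT x.1 y.1 a - feedback k μ hT x.1 y.1 t‖ * (2 * C + lam * (2 * R)) ≤ η)
    (hε : 0 < ε) {x y : AC n α hT} (hx : x ∈ continuations hT cH g)
    (hy : y ∈ continuations hT cH g) :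
    ∃ x' ∈ continuations hT cH g, ∃ y' ∈ continuations hT cH g,
      (∀ τ ∈ Icc 0 (a : ℝ), IccExtend hT x'.1 τ = IccExtend hT x.1 τ) ∧
      (∀ τ ∈ Icc 0 (a : ℝ), IccExtend hT y'.1 τ = IccExtend hT y.1 τ) ∧
      φpos (trunc x' b) - φneg (trunc y' b) ≤ φpos (trunc x a) - φneg (trunc y a) +
        (∫ t in (a : ℝ)..b, (growth α k μ lam hT x'.1 y'.1 t + η)) + 2 * ε := by
  have haT : (a : ℝ) < T := hab.trans_le b.2.2
  set s₀ := feedback k μ hT x.1 y.1 a with hs₀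
  obtain ⟨p, hp, hpφ⟩ := hpos.stable (trunc x a) haT b hab s₀ ε hε
  obtain ⟨q, hq, hqφ⟩ := hneg.stable (trunc y a) haT b hab s₀ ε hε
  have hpc := mem_continuations_of_mem_CH hp
  have hqc := mem_continuations_of_mem_CH hq
  have hpa : ∀ τ ∈ Icc 0 (a : ℝ), IccExtend hT p.1.1 τ = IccExtend hT x.1 τ := fun τ hτ =>
    (hpc.1 τ hτ).trans (extend_trunc x a hτ)
  have hqa : ∀ τ ∈ Icc 0 (a : ℝ), IccExtend hT q.1.1 τ = IccExtend hT y.1 τ := fun τ hτ =>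
    (hqc.1 τ hτ).trans (extend_trunc y a hτ)
  have hpg := continuations_trans hα hx hga hpc
  have hqg := continuations_trans hα hy hga hqc
  refine ⟨p.1, hpg, q.1, hqg, hpa, hqa, ?_⟩
  obtain ⟨hpi, hpz⟩ : IntervalIntegrable (deriv p.2) volume a b ∧
      p.2 b = ∫ t in (a : ℝ)..b, deriv p.2 t := CH_integral_deriv hp ⟨hab.le, b.2.2⟩
  obtain ⟨hqi, hqz⟩ : IntervalIntegrable (deriv q.2) volume a b ∧
      q.2 b = ∫ t in (a : ℝ)..b, deriv q.2 t := CH_integral_deriv hq ⟨hab.le, b.2.2⟩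
  have haa : (a : ℝ) ∈ Icc 0 (a : ℝ) := right_mem_Icc.2 a.2.1
  have hs₀' : feedback k μ hT p.1.1 q.1.1 a = s₀ := feedback_congr k μ (hpa a haa) (hqa a haa)
  have hle : ∫ t in (a : ℝ)..b, (deriv p.2 t - deriv q.2 t) ≤
      ∫ t in (a : ℝ)..b, (growth α k μ lam hT p.1.1 q.1.1 t + η) := by
    refine intervalIntegral.integral_mono_ae_restrict hab.le (hpi.sub hqi)
      ((intervalIntegrable_growth hα k μ lam p.1.2 q.1.2 a.2 b.2).add
        intervalIntegrable_const) ?_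
    have hsub : Icc (a : ℝ) b ⊆ Icc 0 T := Icc_subset_Icc a.2.1 b.2.2
    have hsub' : Icc (a : ℝ) b ⊆ Icc a T := Icc_subset_Icc_right b.2.2
    filter_upwards [ae_restrict_of_ae_restrict_of_subset hsub (hbound _ hpg).2,
      ae_restrict_of_ae_restrict_of_subset hsub (hbound _ hqg).2,
      ae_restrict_of_ae_restrict_of_subset hsub' hp.2.2.2,
      ae_restrict_of_ae_restrict_of_subset hsub' hq.2.2.2,
      ae_restrict_mem measurableSet_Icc] with t h1 h2 h3 h4 ht
    have hX := (hbound _ hpg).1 t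
    have hY := (hbound _ hqg).1 t
    have e1 : deriv p.2 t = inner ℝ s₀ (caputo α hT p.1.1 t) - H t (IccExtend hT p.1.1 t) s₀ :=
      h3.2
    have e2 : deriv q.2 t = inner ℝ s₀ (caputo α hT q.1.1 t) - H t (IccExtend hT q.1.1 t) s₀ :=
      h4.2
    have key := inner_sub_le_of_feedback (d := caputo α hT p.1.1 t - caputo α hT q.1.1 t)
      (D := 2 * C) (W := 2 * R) hlam (hH t (hsub ht) _ _ s₀ hX hY)
      ((norm_sub_le _ _).trans (by linarith)) ((norm_sub_le _ _).trans (by linarith))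
      (hs₀' ▸ hmesh _ hpg _ hqg t ht)
    rw [inner_sub_right] at key
    rw [e1, e2, growth]
    linarith
  rw [intervalIntegral.integral_sub hpi hqi] at hle
  linarith

/-- Lets the growth accumulated in earlier steps survive when the pair of paths is replaced in the
next step. -/
theorem integral_growth_congr (hα : α ∈ Ioo (0 : ℝ) 1) (k μ lam : ℝ) {hT : 0 ≤ T}
    {x x' y y' : C(Icc (0 : ℝ) T, Vec n)} {a b : ℝ} (ha : 0 ≤ a) (hab : a ≤ b) (η : ℝ)
    (hx : ∀ τ ∈ Icc 0 b, IccExtend hT x' τ = IccExtend hT x τ)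
    (hy : ∀ τ ∈ Icc 0 b, IccExtend hT y' τ = IccExtend hT y τ) :
    ∫ t in a..b, (growth α k μ lam hT x' y' t + η) =
      ∫ t in a..b, (growth α k μ lam hT x y t + η) := by
  refine intervalIntegral.integral_congr_uIoo fun t ht => ?_
  rw [uIoo_of_le hab] at ht
  have h0 : t ∈ Ioo 0 b := ⟨ha.trans_lt ht.1, ht.2⟩
  have h1 := hx t (Ioo_subset_Icc_self h0)
  have h2 := hy t (Ioo_subset_Icc_self h0)
  simp only [growth, feedback_congr k μ h1 h2, caputo_congr hα hx h0, caputo_congr hα hy h0, h1, h2]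

/-- The comparison of an upper and a lower solution along a pair of paths. -/
theorem exists_pair (hα : α ∈ Ioo (0 : ℝ) 1) (hT : 0 < T) {H : ℝ → Vec n → Vec n → ℝ}
    {cH : ℝ} {σ : AC n α hT.le → ℝ} {φpos φneg : G n α T → ℝ}
    (hpos : IsUpperSolution hT.le H cH σ φpos) (hneg : IsLowerSolution hT.le H cH σ φneg)
    {g : G n α T} (hg : g.1.time < T) {R C lam : ℝ} (hR : 0 ≤ R) (hC : 0 ≤ C) (hlam : 0 ≤ lam)
    (hbound : ∀ x ∈ continuations hT.le cH g, (∀ t, ‖IccExtend hT.le x.1 t‖ ≤ R) ∧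
      ∀ᵐ t ∂volume.restrict (Icc 0 T), ‖caputo α hT.le x.1 t‖ ≤ C)
    (hH : ∀ t ∈ Icc 0 T, ∀ x x' s : Vec n, ‖x‖ ≤ R → ‖x'‖ ≤ R →
      |H t x s - H t x' s| ≤ lam * (1 + ‖s‖) * ‖x - x'‖)
    {k μ η : ℝ} (hk : 0 ≤ k) (hμ : 0 ≤ μ) (hη : 0 < η) :
    ∃ x ∈ continuations hT.le cH g, ∃ y ∈ continuations hT.le cH g,
      σ x - σ y ≤ φpos g - φneg g +
        (∫ t in g.1.time..T, (growth α k μ lam hT.le x.1 y.1 t + η)) + η := by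
  set t₀ := g.1.time with ht₀
  have ht₀0 : 0 ≤ t₀ := g.1.time_nonneg
  obtain ⟨δ, hδ, hmesh⟩ := exists_delta_feedback hα hT (L := 2 * C + lam * (2 * R)) hk hμ hC
    (by positivity) hη (continuations hT.le cH g) hbound
  obtain ⟨N, hN⟩ := exists_nat_gt ((T - t₀) / δ)
  have hTt : 0 < T - t₀ := sub_pos.2 hg
  have hN0 : (0 : ℝ) < N := (div_pos hTt hδ).trans hN
  set h := (T - t₀) / N with hh
  have hh0 : 0 < h := div_pos hTt hN0
  have hhδ : h ≤ δ := by
    rw [hh, div_le_iff₀ hN0]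
    rw [div_lt_iff₀ hδ] at hN
    linarith
  have hNh : t₀ + N * h = T := by
    rw [hh, mul_div_cancel₀ _ hN0.ne']; ring
  have hmem : ∀ i : ℕ, i ≤ N → t₀ + i * h ∈ Icc 0 T := fun i hi => by
    refine ⟨by positivity, ?_⟩
    rw [← hNh]
    have : (i : ℝ) ≤ N := by exact_mod_cast hi
    gcongr
  have hind : ∀ i : ℕ, ∀ hi : i ≤ N, ∃ x ∈ continuations hT.le cH g,
      ∃ y ∈ continuations hT.le cH g,
      φpos (trunc x ⟨_, hmem i hi⟩) - φneg (trunc y ⟨_, hmem i hi⟩) ≤ φpos g - φneg g +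
        (∫ t in t₀..(t₀ + i * h), (growth α k μ lam hT.le x.1 y.1 t + η)) + i * (η / N) := by
    intro i
    induction i with
    | zero =>
      intro hi
      -- Any continuation of `g` will do for both paths; the terminal time, s = 0 and ε = 1 are
      -- arbitrary.
      obtain ⟨p, hp, -⟩ := hpos.stable g hg ⟨T, right_mem_Icc.2 hT.le⟩ hg 0 1 one_pos
      have hx := mem_continuations_of_mem_CH hp
      refine ⟨p.1, hx, p.1, hx, ?_⟩
      have e : (⟨t₀ + (0 : ℕ) * h, hmem 0 hi⟩ : Icc (0 : ℝ) T) =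
          ⟨g.1.time, g.1.time_nonneg, g.1.time_le⟩ := Subtype.ext (by simp [ht₀])
      rw [e, trunc_eq_of_mem_continuations hx]
      simp
    | succ i ih =>
      intro hi
      have hi' : i ≤ N := (Nat.le_succ i).trans hi
      obtain ⟨x, hx, y, hy, hxy⟩ := ih hi'
      have hga : t₀ ≤ t₀ + i * h := by
        have : 0 ≤ i * h := by positivity
        linarith
      have hstep : t₀ + (i + 1 : ℕ) * h = t₀ + i * h + h := by push_cast; ring
      have hab : t₀ + i * h < t₀ + (i + 1 : ℕ) * h := by rw [hstep]; linarith
      -- Each step loses 2ε = η / N, which adds up to η over the N steps.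
      obtain ⟨x', hx', y', hy', hxa, hya, hle⟩ := exists_step hα hpos hneg hlam hbound hH
        (k := k) (μ := μ) (η := η) (ε := η / N / 2) (a := ⟨_, hmem i hi'⟩)
        (b := ⟨_, hmem (i + 1) hi⟩) hga hab
        (fun x hx y hy t ht => hmesh x hx y hy _ (hmem i hi') t
          ⟨(hmem i hi').1.trans ht.1, ht.2.trans (hmem (i + 1) hi).2⟩ (by
            rw [abs_sub_comm, abs_of_nonneg (sub_nonneg.2 ht.1)]
            have := ht.2
            simp only [hstep] at this
            linarith))
        (by positivity) hx hy
      refine ⟨x', hx', y', hy', ?_⟩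
      have hgi : ∀ {a b : ℝ}, a ∈ Icc 0 T → b ∈ Icc 0 T →
          IntervalIntegrable (fun t => growth α k μ lam hT.le x'.1 y'.1 t + η) volume a b :=
        fun ha hb => (intervalIntegrable_growth hα k μ lam x'.2 y'.2 ha hb).add
          intervalIntegrable_const
      rw [← intervalIntegral.integral_add_adjacent_intervals
        (hgi ⟨ht₀0, g.1.time_le⟩ (hmem i hi')) (hgi (hmem i hi') (hmem (i + 1) hi)),
        integral_growth_congr hα k μ lam ht₀0 hga η hxa hya]
      push_cast at hle ⊢
      linarith
  obtain ⟨x, hx, y, hy, hxy⟩ := hind N le_rfl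
  refine ⟨x, hx, y, hy, ?_⟩
  have e : (⟨t₀ + N * h, hmem N le_rfl⟩ : Icc (0 : ℝ) T) = ⟨T, right_mem_Icc.2 hT.le⟩ :=
    Subtype.ext hNh
  rw [e, trunc_eq_terminal, trunc_eq_terminal, hNh, mul_div_cancel₀ _ hN0.ne'] at hxy
  have := hpos.boundary x
  have := hneg.boundary y
  linarith

end

/-! ### Absorption of the growth and passage to the limit. -/

section

variable {n : ℕ} {α T : ℝ}

/-! ### Estimate of the accumulated growth -/

theorem rlIntegral_sub {C C' τ : ℝ} (hα : 0 < α) (hτ : 0 ≤ τ) {ψ ψ' : ℝ → Vec n}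
    (hψ : StronglyMeasurable ψ) (hC : ∀ ξ, ‖ψ ξ‖ ≤ C) (hψ' : StronglyMeasurable ψ')
    (hC' : ∀ ξ, ‖ψ' ξ‖ ≤ C') :
    rlIntegral α (fun ξ => ψ ξ - ψ' ξ) τ = rlIntegral α ψ τ - rlIntegral α ψ' τ := by
  simp only [rlIntegral_of_pos hα, smul_sub]
  rw [intervalIntegral.integral_sub, smul_sub]
  · exact intervalIntegrable_kernel_smul hα hτ le_rfl hψ.aestronglyMeasurable
      (Eventually.of_forall hC)
  · exact intervalIntegrable_kernel_smul hα hτ le_rfl hψ'.aestronglyMeasurable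
      (Eventually.of_forall hC')

theorem growth_eq_zero {k μ lam : ℝ} {hT : 0 ≤ T} {x y : C(Icc (0 : ℝ) T, Vec n)} {t : ℝ}
    (h : IccExtend hT x t = IccExtend hT y t) : growth α k μ lam hT x y t = 0 := by
  simp [growth, feedback, h]

/-- The weighted form of the coercivity for the difference of two paths. -/
theorem integral_growth_le (hα : α ∈ Ioo (0 : ℝ) 1) {S : ℝ} (hS : 0 < S)
    (hco : ∀ (n : ℕ) (μ T C : ℝ), 0 < μ → 0 ≤ T → ∀ u : ℝ → Vec n, StronglyMeasurable u →
      (∀ ξ, ‖u ξ‖ ≤ C) →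
      μ ^ α * ∫ t in (0 : ℝ)..T, Real.exp (-(2 * μ * t)) * ‖rlIntegral α u t‖ ^ 2 ≤
        S * ∫ t in (0 : ℝ)..T, Real.exp (-(2 * μ * t)) * inner ℝ (rlIntegral α u t) (u t))
    {k μ lam t₀ : ℝ} (hk : 0 < k) (hμ : 0 < μ) (hlam : 0 < lam) (hμα : S * (2 * lam) ≤ μ ^ α)
    {hT : 0 ≤ T} {x y : C(Icc (0 : ℝ) T, Vec n)} (hx : x ∈ AC n α hT) (hy : y ∈ AC n α hT)
    (ht₀ : t₀ ∈ Icc 0 T) (hxy : ∀ t ∈ Icc 0 t₀, IccExtend hT x t = IccExtend hT y t) :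
    ∫ t in t₀..T, growth α k μ lam hT x y t ≤
      lam * T / (2 * k * Real.exp (-(2 * μ * T))) -
        k * lam * Real.exp (-(2 * μ * T)) / 2 *
          ∫ t in (0 : ℝ)..T, ‖IccExtend hT x t - IccExtend hT y t‖ ^ 2 := by
  obtain ⟨ψ, C, hψ⟩ := exists_isDensity hα.1 hx
  obtain ⟨ψ', C', hψ'⟩ := exists_isDensity hα.1 hy
  set u : ℝ → Vec n := fun ξ => ψ ξ - ψ' ξ with hu
  have hum : StronglyMeasurable u := hψ.1.sub hψ'.1
  have huC : ∀ ξ, ‖u ξ‖ ≤ C + C' := fun ξ =>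
    (norm_sub_le _ _).trans (add_le_add (hψ.2 ξ) (hψ'.2 ξ))
  set w : ℝ → Vec n := fun t => IccExtend hT x t - IccExtend hT y t with hw
  have hwc : Continuous w := (continuous_extend x).sub (continuous_extend y)
  have h00 : IccExtend hT x 0 = IccExtend hT y 0 := hxy 0 (left_mem_Icc.2 ht₀.1)
  have hwu : ∀ t ∈ Icc 0 T, w t = rlIntegral α u t := fun t ht => by
    rw [hu, rlIntegral_sub hα.1 ht.1 hψ.1 hψ.2 hψ'.1 hψ'.2, ← hψ.extend_sub ht,
      ← hψ'.extend_sub ht, h00, sub_sub_sub_cancel_right]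
  set e : ℝ → ℝ := fun t => Real.exp (-(2 * μ * t)) with he
  have hec : Continuous e := by simp only [he]; fun_prop
  set b := e T with hb
  have hb0 : 0 < b := Real.exp_pos _
  have heb : ∀ t ∈ Icc 0 T, b ≤ e t := fun t ht => by
    refine Real.exp_le_exp.2 (neg_le_neg ?_)
    have := ht.2
    gcongr
  -- By the choice of μ the coercivity yields 2 lam: one lam cancels the quadratic part of the
  -- Lipschitz term, the other absorbs its linear part.
  have hI : S * (2 * lam * ∫ t in (0 : ℝ)..T, e t * ‖w t‖ ^ 2) ≤
      S * ∫ t in (0 : ℝ)..T, e t * inner ℝ (w t) (u t) := by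
    have h1 := hco n μ T (C + C') hμ hT u hum huC
    have e1 : ∫ t in (0 : ℝ)..T, Real.exp (-(2 * μ * t)) * ‖rlIntegral α u t‖ ^ 2 =
        ∫ t in (0 : ℝ)..T, e t * ‖w t‖ ^ 2 := by
      refine intervalIntegral.integral_congr fun t ht => ?_
      rw [uIcc_of_le hT] at ht
      simp only [hwu t ht, he]
    have e2 : ∫ t in (0 : ℝ)..T, Real.exp (-(2 * μ * t)) * inner ℝ (rlIntegral α u t) (u t) =
        ∫ t in (0 : ℝ)..T, e t * inner ℝ (w t) (u t) := by
      refine intervalIntegral.integral_congr fun t ht => ?_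
      rw [uIcc_of_le hT] at ht
      simp only [hwu t ht, he]
    rw [e1, e2] at h1
    have h2 : 0 ≤ ∫ t in (0 : ℝ)..T, e t * ‖w t‖ ^ 2 :=
      intervalIntegral.integral_nonneg hT fun t _ => by
        have : 0 < e t := Real.exp_pos _
        positivity
    calc _ = S * (2 * lam) * ∫ t in (0 : ℝ)..T, e t * ‖w t‖ ^ 2 := by ring
      _ ≤ μ ^ α * ∫ t in (0 : ℝ)..T, e t * ‖w t‖ ^ 2 := by gcongr
      _ ≤ _ := h1
  have hI' := le_of_mul_le_mul_left hI hS
  have hgi : ∀ {a b : ℝ}, a ∈ Icc 0 T → b ∈ Icc 0 T →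
      IntervalIntegrable (growth α k μ lam hT x y) volume a b := fun ha hb =>
    intervalIntegrable_growth hα k μ lam hx hy ha hb
  have h0T : (0 : ℝ) ∈ Icc 0 T := left_mem_Icc.2 hT
  have hTT : T ∈ Icc 0 T := right_mem_Icc.2 hT
  -- Coercivity is an estimate from time 0; the integral may start there because the growth vanishes
  -- while the paths coincide.
  have hzero : ∫ t in (0 : ℝ)..t₀, growth α k μ lam hT x y t = 0 := by
    refine (intervalIntegral.integral_congr (g := fun _ => (0 : ℝ)) fun t ht => ?_).trans
      intervalIntegral.integral_zero
    rw [uIcc_of_le ht₀.1] at ht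
    exact growth_eq_zero (hxy t ht)
  have hsplit : ∫ t in t₀..T, growth α k μ lam hT x y t =
      ∫ t in (0 : ℝ)..T, growth α k μ lam hT x y t := by
    rw [← intervalIntegral.integral_add_adjacent_intervals (hgi h0T ht₀) (hgi ht₀ hTT), hzero,
      zero_add]
  have hform : ∫ t in (0 : ℝ)..T, growth α k μ lam hT x y t =
      ∫ t in (0 : ℝ)..T, (-k * (e t * inner ℝ (w t) (u t)) +
        (lam * ‖w t‖ + lam * k * (e t * ‖w t‖ ^ 2))) := by
    refine intervalIntegral.integral_congr_ae_restrict ?_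
    rw [uIoc_of_le hT]
    filter_upwards [ae_restrict_of_ae_restrict_of_subset Ioc_subset_Icc_self
      (hψ.caputo_ae_eq hα), ae_restrict_of_ae_restrict_of_subset Ioc_subset_Icc_self
      (hψ'.caputo_ae_eq hα)] with t h1 h2
    have hf : feedback k μ hT x y t = (-(k * e t)) • w t := rfl
    have hke : 0 ≤ k * e t := mul_nonneg hk.le (Real.exp_pos _).le
    rw [growth, h1, h2, hf, norm_smul, norm_neg, Real.norm_of_nonneg hke, inner_smul_left]
    simp only [conj_trivial, hu]
    change _ + lam * (1 + k * e t * ‖w t‖) * ‖w t‖ = _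
    ring
  have hi1 : IntervalIntegrable (fun t => e t * inner ℝ (w t) (u t)) volume 0 T := by
    have := intervalIntegrable_inner_of_bounded (a := 0) (b := T) hwc hum huC
    exact this.continuousOn_mul hec.continuousOn
  have hi2 : IntervalIntegrable (fun t => e t * ‖w t‖ ^ 2) volume 0 T :=
    (hec.mul (hwc.norm.pow 2)).intervalIntegrable _ _
  have hi3 : IntervalIntegrable (fun t => lam * ‖w t‖) volume 0 T :=
    (continuous_const.mul hwc.norm).intervalIntegrable _ _
  have hi4 : IntervalIntegrable (fun t => ‖w t‖ ^ 2) volume 0 T :=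
    (hwc.norm.pow 2).intervalIntegrable _ _
  -- Young's inequality uses half of k b ‖w‖²; the other half is kept as the negative penalty term.
  have hyoung : ∫ t in (0 : ℝ)..T, lam * ‖w t‖ ≤
      ∫ t in (0 : ℝ)..T, (lam * k * (e t * ‖w t‖ ^ 2) - k * lam * b / 2 * ‖w t‖ ^ 2 +
        lam / (2 * k * b)) := by
    refine intervalIntegral.integral_mono_on hT hi3 (((hi2.const_mul _).sub
      (hi4.const_mul _)).add intervalIntegrable_const) fun t ht => ?_
    have h1 : ‖w t‖ ≤ k * b / 2 * ‖w t‖ ^ 2 + 1 / (2 * k * b) := by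
      have h2 : k * b / 2 * ‖w t‖ ^ 2 + 1 / (2 * k * b) - ‖w t‖ =
          (k * b * ‖w t‖ - 1) ^ 2 / (2 * k * b) := by
        field_simp
        ring
      have h3 : 0 ≤ (k * b * ‖w t‖ - 1) ^ 2 / (2 * k * b) := by positivity
      linarith
    have h4 : k * b * ‖w t‖ ^ 2 ≤ k * e t * ‖w t‖ ^ 2 := by
      have := heb t ht
      gcongr
    calc lam * ‖w t‖ ≤ lam * (k * b / 2 * ‖w t‖ ^ 2 + 1 / (2 * k * b)) := by gcongr
      _ = lam * (k * b * ‖w t‖ ^ 2) - k * lam * b / 2 * ‖w t‖ ^ 2 + lam / (2 * k * b) := by ring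
      _ ≤ lam * (k * e t * ‖w t‖ ^ 2) - k * lam * b / 2 * ‖w t‖ ^ 2 + lam / (2 * k * b) := by
          gcongr
      _ = _ := by ring
  rw [intervalIntegral.integral_add ((hi2.const_mul _).sub (hi4.const_mul _))
    intervalIntegrable_const, intervalIntegral.integral_sub (hi2.const_mul _) (hi4.const_mul _),
    intervalIntegral.integral_const, smul_eq_mul, sub_zero] at hyoung
  rw [hsplit, hform, intervalIntegral.integral_add (hi1.const_mul _) (hi3.add (hi2.const_mul _)),
    intervalIntegral.integral_add hi3 (hi2.const_mul _)]
  have hkI := mul_le_mul_of_nonneg_left hI' hk.le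
  have e3 : T * (lam / (2 * k * b)) = lam * T / (2 * k * b) := by ring
  rw [e3] at hyoung
  change _ ≤ lam * T / (2 * k * b) - k * lam * b / 2 * ∫ t in (0 : ℝ)..T, ‖w t‖ ^ 2
  simp only [intervalIntegral.integral_const_mul] at hyoung ⊢
  linarith

/-! ### The comparison principle -/

theorem continuous_integral_norm_sub_sq (hT : 0 ≤ T) :
    Continuous fun p : AC n α hT × AC n α hT =>
      ∫ t in (0 : ℝ)..T, ‖IccExtend hT p.1.1 t - IccExtend hT p.2.1 t‖ ^ 2 := by
  refine intervalIntegral.continuous_parametric_intervalIntegral_of_continuous' ?_ 0 T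
  have h : ∀ f : (AC n α hT × AC n α hT) × ℝ → C(Icc (0 : ℝ) T, Vec n), Continuous f →
      Continuous fun q : (AC n α hT × AC n α hT) × ℝ => IccExtend hT (f q) q.2 := fun f hf =>
    hf.eval (continuous_projIcc.comp continuous_snd)
  exact ((h (fun q => q.1.1.1) (by fun_prop)).sub (h (fun q => q.1.2.1) (by fun_prop))).norm.pow 2

theorem eq_of_integral_norm_sub_sq_le (hT : 0 < T) {x y : AC n α hT.le}
    (h : ∫ t in (0 : ℝ)..T, ‖IccExtend hT.le x.1 t - IccExtend hT.le y.1 t‖ ^ 2 ≤ 0) : x = y := by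
  by_contra hne
  have hne' : x.1 ≠ y.1 := fun h => hne (Subtype.ext h)
  obtain ⟨t, ht⟩ : ∃ t, x.1 t ≠ y.1 t := by
    by_contra! hc
    exact hne' (ContinuousMap.ext hc)
  have hc : Continuous fun t => ‖IccExtend hT.le x.1 t - IccExtend hT.le y.1 t‖ ^ 2 :=
    ((continuous_extend _).sub (continuous_extend _)).norm.pow 2
  have := intervalIntegral.integral_pos hT hc.continuousOn (fun _ _ => by positivity)
    ⟨t, t.2, by
      rw [IccExtend_of_mem _ _ t.2, IccExtend_of_mem _ _ t.2]
      have : 0 < ‖x.1 t - y.1 t‖ := norm_pos_iff.2 (sub_ne_zero.2 ht)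
      positivity⟩
  linarith

/-- Compactness passes to the subtype on which σ is defined because every element of `boundedPaths`
has a density. -/
theorem isCompact_preimage_boundedPaths (hα : α ∈ Ioo (0 : ℝ) 1) (hT : 0 < T) {C : ℝ}
    (hC : 0 ≤ C) (a : Vec n) :
    IsCompact {x : AC n α hT.le | x.1 ∈ boundedPaths α hT.le a C} := by
  refine Topology.IsInducing.subtypeVal.isCompact_preimage' (isCompact_boundedPaths hα hT hC a) ?_
  intro x hx
  obtain ⟨ψ, hψ⟩ := exists_isDensity_of_mem_boundedPaths hα hT hC hx
  exact ⟨⟨x, hψ.mem_AC⟩, rfl⟩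

theorem comparison_of_time_lt (hα : α ∈ Ioo (0 : ℝ) 1) (hT : 0 < T)
    {H : ℝ → Vec n → Vec n → ℝ} {cH : ℝ} (hcH : 0 < cH) {σ : AC n α hT.le → ℝ}
    (hH : ∀ R : ℝ, 0 ≤ R → ∃ lam : ℝ, 0 < lam ∧ ∀ t ∈ Icc 0 T, ∀ x x' s : Vec n,
      ‖x‖ ≤ R → ‖x'‖ ≤ R → |H t x s - H t x' s| ≤ lam * (1 + ‖s‖) * ‖x - x'‖)
    (hσ : Continuous σ) {φpos φneg : G n α T → ℝ}
    (hpos : IsUpperSolution hT.le H cH σ φpos) (hneg : IsLowerSolution hT.le H cH σ φneg)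
    {g : G n α T} (hg : g.1.time < T) : φneg g ≤ φpos g := by
  obtain ⟨R, C, hR, hC, hbound⟩ := exists_bound_continuations hα hT.le hcH g
  obtain ⟨lam, hlam, hHR⟩ := hH R hR
  obtain ⟨S, hS, hco⟩ := exists_coercive hα
  -- Independent of k, so the weight b below stays fixed while the penalty grows.
  set μ := (S * (2 * lam)) ^ (1 / α) with hμdef
  have hμ : 0 < μ := Real.rpow_pos_of_pos (by positivity) _
  have hμα : S * (2 * lam) ≤ μ ^ α := by
    rw [hμdef, ← Real.rpow_mul (by positivity), one_div_mul_cancel hα.1.ne', Real.rpow_one]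
  set b := Real.exp (-(2 * μ * T)) with hb
  have hb0 : 0 < b := Real.exp_pos _
  set a := g.1.path ⟨0, left_mem_Icc.2 g.1.time_nonneg⟩ with ha
  set K : Set (AC n α hT.le) := {x | x.1 ∈ boundedPaths α hT.le a C} with hK
  have hKc : IsCompact K := isCompact_preimage_boundedPaths hα hT hC a
  have hsubK : ∀ x ∈ continuations hT.le cH g, x ∈ K := fun x hx => by
    have h0 : x.1 ⟨0, left_mem_Icc.2 hT.le⟩ = a := by
      have := hx.1 0 (left_mem_Icc.2 g.1.time_nonneg)
      rwa [IccExtend_of_mem hT.le _ (left_mem_Icc.2 hT.le),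
        IccExtend_of_mem _ _ (left_mem_Icc.2 g.1.time_nonneg)] at this
    have := mem_boundedPaths_of_caputo hα x.2 (hbound x hx).2
    rwa [h0] at this
  let I : AC n α hT.le × AC n α hT.le → ℝ := fun p =>
    ∫ t in (0 : ℝ)..T, ‖IccExtend hT.le p.1.1 t - IccExtend hT.le p.2.1 t‖ ^ 2
  have hIc : Continuous I := continuous_integral_norm_sub_sq hT.le
  -- Here k = m + 1 and η = 1/(m + 1). In the constant, lam T / (2b) comes from Young's inequality,
  -- T from integrating η, and 1 from the accumulated errors of the steps.
  have hex : ∀ m : ℕ, ∃ p : AC n α hT.le × AC n α hT.le, p ∈ K ×ˢ K ∧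
      σ p.1 - σ p.2 + (m + 1) * (lam * b / 2) * I p ≤ φpos g - φneg g +
        (lam * T / (2 * b) + (T + 1)) * (1 / ((m : ℝ) + 1)) := by
    intro m
    have hm : (0 : ℝ) < m + 1 := by positivity
    obtain ⟨x, hx, y, hy, hxy⟩ := exists_pair hα hT hpos hneg hg hR hC hlam.le hbound hHR
      (k := m + 1) (μ := μ) (η := 1 / (m + 1)) hm.le hμ.le (by positivity)
    refine ⟨(x, y), ⟨hsubK x hx, hsubK y hy⟩, ?_⟩
    have hgT : g.1.time ∈ Icc 0 T := ⟨g.1.time_nonneg, g.1.time_le⟩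
    have hest := integral_growth_le hα hS hco hm hμ hlam hμα x.2 y.2 hgT
      fun t ht => (hx.1 t ht).trans (hy.1 t ht).symm
    rw [intervalIntegral.integral_add
      (intervalIntegrable_growth hα _ μ lam x.2 y.2 hgT (right_mem_Icc.2 hT.le))
      intervalIntegrable_const, intervalIntegral.integral_const, smul_eq_mul] at hxy
    have h1 : (T - g.1.time) * (1 / ((m : ℝ) + 1)) ≤ T * (1 / ((m : ℝ) + 1)) := by
      have := g.1.time_nonneg
      gcongr
      linarith
    have h2 : lam * T / (2 * ((m : ℝ) + 1) * b) = lam * T / (2 * b) * (1 / ((m : ℝ) + 1)) := by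
      field_simp
    have h3 : ((m : ℝ) + 1) * lam * b / 2 * I (x, y) = (m + 1) * (lam * b / 2) * I (x, y) := by
      ring
    have hest' : ∫ t in g.1.time..T, growth α (m + 1) μ lam hT.le x.1 y.1 t ≤
        lam * T / (2 * ((m : ℝ) + 1) * b) - ((m : ℝ) + 1) * lam * b / 2 * I (x, y) := hest
    rw [h2, h3] at hest'
    linarith
  choose p hpK hp using hex
  obtain ⟨q, hqK, θ, hθ, hlim⟩ := (hKc.prod hKc).tendsto_subseq hpK
  have hσlim : Tendsto (fun m => σ (p (θ m)).1 - σ (p (θ m)).2) atTop (𝓝 (σ q.1 - σ q.2)) :=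
    ((hσ.comp continuous_fst).sub (hσ.comp continuous_snd)).continuousAt.tendsto.comp hlim
  have hIlim : Tendsto (fun m => I (p (θ m))) atTop (𝓝 (I q)) :=
    hIc.continuousAt.tendsto.comp hlim
  have hinv : Tendsto (fun m => 1 / ((θ m : ℝ) + 1)) atTop (𝓝 0) :=
    tendsto_one_div_add_atTop_nhds_zero_nat.comp hθ.tendsto_atTop
  have hrhs : Tendsto (fun m => φpos g - φneg g +
      (lam * T / (2 * b) + (T + 1)) * (1 / ((θ m : ℝ) + 1))) atTop (𝓝 (φpos g - φneg g)) := by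
    simpa using (hinv.const_mul (lam * T / (2 * b) + (T + 1))).const_add (φpos g - φneg g)
  have hI0 : ∀ p, 0 ≤ I p := fun p =>
    intervalIntegral.integral_nonneg hT.le fun _ _ => by positivity
  -- Divide by m + 1: apart from the penalty, all terms are bounded along the subsequence, so the
  -- two limit paths are at L² distance zero.
  have hIq : lam * b / 2 * I q ≤ 0 := by
    have h1 : Tendsto (fun m => (1 / ((θ m : ℝ) + 1)) * (φpos g - φneg g +
        (lam * T / (2 * b) + (T + 1)) * (1 / ((θ m : ℝ) + 1)) -
        (σ (p (θ m)).1 - σ (p (θ m)).2))) atTop (𝓝 0) := by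
      simpa using hinv.mul (hrhs.sub hσlim)
    refine le_of_tendsto_of_tendsto' (hIlim.const_mul _) h1 fun m => ?_
    have hm : (0 : ℝ) < (θ m : ℝ) + 1 := by positivity
    rw [one_div_mul_eq_div, le_div_iff₀ hm]
    have := hp (θ m)
    linarith
  have hIq' : I q ≤ 0 := nonpos_of_mul_nonpos_right hIq (by positivity)
  have hq : q.1 = q.2 := eq_of_integral_norm_sub_sq_le hT hIq'
  have hfin : σ q.1 - σ q.2 ≤ φpos g - φneg g := by
    refine le_of_tendsto_of_tendsto' hσlim hrhs fun m => ?_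
    have h1 := hp (θ m)
    have h2 : 0 ≤ ((θ m : ℝ) + 1) * (lam * b / 2) * I (p (θ m)) :=
      mul_nonneg (by positivity) (hI0 _)
    linarith
  rw [hq, sub_self] at hfin
  linarith

end

end FracHJ

theorem mainTheorem2 (n : ℕ) (α T : ℝ) (hα : α ∈ Set.Ioo (0 : ℝ) 1) (hT : 0 < T)
    (H : ℝ → FracHJ.Vec n → FracHJ.Vec n → ℝ) (cH : ℝ) (σ : FracHJ.AC n α hT.le → ℝ)
    (hH₁ : ContinuousOn (fun p : ℝ × FracHJ.Vec n × FracHJ.Vec n => H p.1 p.2.1 p.2.2)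
      (Set.Icc 0 T ×ˢ Set.univ))
    (hcH : 0 < cH)
    (hH₂ : ∀ t ∈ Set.Icc 0 T, ∀ x s s' : FracHJ.Vec n,
      |H t x s - H t x s'| ≤ cH * (1 + ‖x‖) * ‖s - s'‖)
    (hH₃ : ∀ R : ℝ, 0 ≤ R → ∃ lam : ℝ, 0 < lam ∧ ∀ t ∈ Set.Icc 0 T, ∀ x x' s : FracHJ.Vec n,
      ‖x‖ ≤ R → ‖x'‖ ≤ R → |H t x s - H t x' s| ≤ lam * (1 + ‖s‖) * ‖x - x'‖)
    (hσ : Continuous σ)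
    (φpos φneg : FracHJ.G n α T → ℝ)
    (hpos : FracHJ.IsUpperSolution hT.le H cH σ φpos)
    (hneg : FracHJ.IsLowerSolution hT.le H cH σ φneg) :
    ∀ g : FracHJ.G n α T, φneg g ≤ φpos g := by
  intro g
  rcases g.1.time_le.lt_or_eq with hg | hg
  · exact FracHJ.comparison_of_time_lt hα hT hcH hH₃ hσ hpos hneg hg
  · obtain ⟨⟨t, h0, h1, w⟩, hw⟩ := g
    obtain rfl : t = T := hg
    exact (hneg.boundary ⟨w, hw⟩).trans (hpos.boundary ⟨w, hw⟩)
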